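/- Let $1\le m\le n$. Let $\mathfrak M_{n,m}$ be the space of real $n\times m$ matrices with Lebesgue measure $dx=\prod dx_{i,j}$; write $x'$ for the transpose and $|x|_m=\det(x'x)^{1/2}$. Let $\mathcal P_m$ be the cone of positive definite symmetric $m\times m$ matrices, with $dr=\prod_{i\le j}dr_{i,j}$ and invariant measure $d_*r=\det(r)^{-(m+1)/2}\,dr$. Write $s>t$ if $s-t\in\mathcal P_m$, and $\int_a^b$ for integration over $\{s: a<s<b\}$. A function $u_0:\mathcal P_m\to\mathbb C$ is called symmetric if $u_0(s^{1/2}rs^{1/2})=u_0(r^{1/2}sr^{1/2})$ for all $r,s\in\mathcal P_m$. Put $\sigma_{n,m}=2^m\pi^{nm/2}/\Gamma_m(n/2)$, where $\Gamma_m(\alpha)=\int_{\mathcal P_m}e^{-\mathrm{tr}\,r}\det(r)^{\alpha-(m+1)/2}\,dr$. Let $\nu$ be a finite complex Borel measure on $\mathfrak M_{n,m}$ that is radial, i.e. $\int\psi(\gamma x)\,d\nu(x)=\int\psi(x)\,d\nu(x)$ for all $\gamma\in SO(n)$ and all continuous compactly supported $\psi$. Let $(\mathcal F\nu)(y)=\int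 e^{i\,\mathrm{tr}(y'x)}\,d\nu(x)$, and suppose that there is a symmetric function $u_0$ on $\mathcal P_m$ with $(\mathcal F\nu)(y)=u_0(y'y)$ for all $y\in\mathfrak M_{n,m}$ of rank $m$. For $A,B\in\mathcal P_m$ put $$K(A,B)=\frac{2^m}{\sigma_{n,m}}\int_{\{z\in\mathfrak M_{n,m}:\,A<z'z<B\}}\frac{(\mathcal F\nu)(z)}{|z|_m^n}\,dz .$$ Suppose that the limit $c_\nu=\lim K(A,B)\in\mathbb C$ exists as $A\to0$ and $B\to\infty$ in $\mathcal P_m$ (where $B\to\infty$ means that the smallest eigenvalue of $B$ tends to $\infty$), and that the truncated integrals $K(A,B)$, $A,B\in\mathcal P_m$, are uniformly bounded. (Both hold, for example, if $\int|(\mathcal F\nu)(z)|\,|z|_m^{-n}\,dz<\infty$.) For $a\in\mathcal P_m$ let $(W_{\nu,a}f)(x)=\int f(x-ya^{1/2})\,d\nu(y)$. Then for every $f\in L^2(\mathfrak M_{n,m})$: (1) for every $a\in\mathcal P_m$, the integral defining $(W_{\nu,a}f)(x)$ converges absolutely for almost every $x$; (2) for all $0<\varepsilon<\rho<\infty$,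 the integral $I_{\varepsilon,\rho}(x)=\int_{\varepsilon I_m}^{\rho I_m}(W_{\nu,a}f)(x)\,d_*a$ converges absolutely for almost every $x$, and $I_{\varepsilon,\rho}\in L^2(\mathfrak M_{n,m})$; (3) $\|I_{\varepsilon,\rho}-c_\nu f\|_{L^2}\to0$ as $\varepsilon\to0$ and $\rho\to\infty$ jointly. -/

import Mathlib

open MeasureTheory Filter Topology
open scoped Matrix CompactlySupported

namespace MatrixWavelet

noncomputable section

/-- The product σ-algebra on the space of real `n × m` matrices. -/
instance matMeasurableSpace (n m : ℕ) : MeasurableSpace (Matrix (Fin n) (Fin m) ℝ) :=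
  inferInstanceAs (MeasurableSpace (Fin n → Fin m → ℝ))

/-- It is the Borel σ-algebra. -/
instance matBorelSpace (n m : ℕ) : BorelSpace (Matrix (Fin n) (Fin m) ℝ) :=
  inferInstanceAs (BorelSpace (Fin n → Fin m → ℝ))

/-- Lebesgue measure `dx = ∏ dx_{i,j}` on the space of real `n × m` matrices. -/
instance matMeasureSpace (n m : ℕ) : MeasureSpace (Matrix (Fin n) (Fin m) ℝ) :=
  inferInstanceAs (MeasureSpace (Fin n → Fin m → ℝ))

/-- The cone of positive definite symmetric `m × m` matrices. -/
def cone (m : ℕ) : Set (Matrix (Fin m) (Fin m) ℝ) := {r | r.PosDef}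

/-- The interval `{s : a < s < b}` for the order in which `a < s` means that `s - a` is
positive definite. -/
def coneInterval {m : ℕ} (a b : Matrix (Fin m) (Fin m) ℝ) : Set (Matrix (Fin m) (Fin m) ℝ) :=
  {s | (s - a).PosDef ∧ (b - s).PosDef}

/-- The symmetric matrix with prescribed entries `r_{i,j}`, `i ≤ j`. -/
def symOfUpper {m : ℕ} (t : {p : Fin m × Fin m // p.1 ≤ p.2} → ℝ) : Matrix (Fin m) (Fin m) ℝ :=
  Matrix.of fun i j => t ⟨(min i j, max i j), min_le_max⟩

/-- The measure `dr = ∏_{i ≤ j} dr_{i,j}` on symmetric matrices (as a measure on all square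
matrices carried by the symmetric ones). -/
def lebSym (m : ℕ) : Measure (Matrix (Fin m) (Fin m) ℝ) :=
  Measure.map symOfUpper (volume : Measure ({p : Fin m × Fin m // p.1 ≤ p.2} → ℝ))

/-- The invariant measure `d_* r = |r|^{-d} dr`, `d = (m + 1) / 2`, on the cone. -/
def dStar (m : ℕ) : Measure (Matrix (Fin m) (Fin m) ℝ) :=
  ((lebSym m).restrict (cone m)).withDensity
    fun r => ENNReal.ofReal (r.det ^ (-(((m : ℝ) + 1) / 2)))

/-- The square root `r^{1/2}` of a positive semidefinite matrix. -/
def msqrt {m : ℕ} (r : Matrix (Fin m) (Fin m) ℝ) : Matrix (Fin m) (Fin m) ℝ :=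
  cfc Real.sqrt r

/-- Symmetric functions on the cone:
`w₀ (s^{1/2} r s^{1/2}) = w₀ (r^{1/2} s r^{1/2})` for all `r`, `s` in the cone. -/
def IsSymmetricOnCone {m : ℕ} (w₀ : Matrix (Fin m) (Fin m) ℝ → ℂ) : Prop :=
  ∀ r s : Matrix (Fin m) (Fin m) ℝ, r.PosDef → s.PosDef →
    w₀ (msqrt s * r * msqrt s) = w₀ (msqrt r * s * msqrt r)

/-- The Siegel gamma function (at a real argument)
`Γ_m(α) = ∫_{P_m} exp(-tr r) |r|^{α-d} dr`, `d = (m + 1) / 2`. -/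
def siegelGamma (m : ℕ) (α : ℝ) : ℝ :=
  ∫ r in cone m, Real.exp (-r.trace) * r.det ^ (α - ((m : ℝ) + 1) / 2) ∂(lebSym m)

/-- The constant `σ_{n,m} = 2^m π^{nm/2} / Γ_m(n/2)`, the total mass of the Stiefel manifold. -/
def stiefelMass (n m : ℕ) : ℝ :=
  2 ^ m * Real.pi ^ ((n : ℝ) * m / 2) / siegelGamma m ((n : ℝ) / 2)

/-- `|x|_m = det(x'x)^{1/2}`. -/
def matVol {n m : ℕ} (x : Matrix (Fin n) (Fin m) ℝ) : ℝ := Real.sqrt (xᵀ * x).det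

/-- The integral `∫ g dν` of a complex function against a complex measure. -/
def cintegral {n m : ℕ} (ν : ComplexMeasure (Matrix (Fin n) (Fin m) ℝ))
    (g : Matrix (Fin n) (Fin m) ℝ → ℂ) : ℂ :=
  ∫ᵛ x, g x ∂[ContinuousLinearMap.mul ℝ ℂ; ν]

/-- Radial measures: `∫ ψ(γx) dν(x) = ∫ ψ(x) dν(x)` for all `γ ∈ SO(n)` and all continuous
compactly supported `ψ`. -/
def IsRadial {n m : ℕ} (ν : ComplexMeasure (Matrix (Fin n) (Fin m) ℝ)) : Prop :=
  ∀ γ ∈ Matrix.specialOrthogonalGroup (Fin n) ℝ, ∀ ψ : C_c(Matrix (Fin n) (Fin m) ℝ, ℂ),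
    cintegral ν (fun x => ψ (γ * x)) = cintegral ν (fun x => ψ x)

/-- The Fourier transform `(Fν)(y) = ∫ exp(tr(i y'x)) dν(x)`. -/
def fourierMeasure {n m : ℕ} (ν : ComplexMeasure (Matrix (Fin n) (Fin m) ℝ))
    (y : Matrix (Fin n) (Fin m) ℝ) : ℂ :=
  cintegral ν fun x => Complex.exp (Complex.I * ((yᵀ * x).trace : ℂ))

/-- The wavelet transform `(W_{ν,a} f)(x) = ∫ f(x - y a^{1/2}) dν(y)`. -/
def waveletTransform {n m : ℕ} (ν : ComplexMeasure (Matrix (Fin n) (Fin m) ℝ))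
    (a : Matrix (Fin m) (Fin m) ℝ) (f : Matrix (Fin n) (Fin m) ℝ → ℂ)
    (x : Matrix (Fin n) (Fin m) ℝ) : ℂ :=
  cintegral ν fun y => f (x - y * msqrt a)

/-- The truncated integral
`∫_{εI}^{ρI} (W_{ν,a} f)(x) d_* a`. -/
def truncatedCalderon {n m : ℕ} (ν : ComplexMeasure (Matrix (Fin n) (Fin m) ℝ)) (ε ρ : ℝ)
    (f : Matrix (Fin n) (Fin m) ℝ → ℂ) (x : Matrix (Fin n) (Fin m) ℝ) : ℂ :=
  ∫ a in coneInterval (ε • (1 : Matrix (Fin m) (Fin m) ℝ)) (ρ • 1),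
    waveletTransform ν a f x ∂(dStar m)

/-- The truncated integral
`(2^m / σ_{n,m}) ∫_{A < z'z < B} (Fν)(z) / |z|_m^n dz` defining the constant `c_ν`. -/
def truncatedConstant {n m : ℕ} (ν : ComplexMeasure (Matrix (Fin n) (Fin m) ℝ))
    (A B : Matrix (Fin m) (Fin m) ℝ) : ℂ :=
  ((2 ^ m / stiefelMass n m : ℝ) : ℂ) *
    ∫ z in {z : Matrix (Fin n) (Fin m) ℝ | zᵀ * z ∈ coneInterval A B},
      fourierMeasure ν z / ((matVol z ^ n : ℝ) : ℂ)

/-- `A → 0` within the cone. -/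
def coneNhdsZero (m : ℕ) : Filter (Matrix (Fin m) (Fin m) ℝ) := 𝓝[cone m] 0

/-- `B → ∞` within the cone: for every real `R`, eventually `B > R I_m`
(i.e. the smallest eigenvalue of `B` tends to infinity). -/
def coneAtTop (m : ℕ) : Filter (Matrix (Fin m) (Fin m) ℝ) :=
  ⨅ R : ℝ, 𝓟 {B | B.PosDef ∧ (B - R • (1 : Matrix (Fin m) (Fin m) ℝ)).PosDef}

end

end MatrixWavelet

open MatrixWavelet

/-! For a phase `k` of `ν`, that is `ν = k·|ν|` with `|k| = 1`, the truncated Calderón integral is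
an average of translates `f (x - y a^{1/2})`, so it is a Fourier multiplier operator. Its symbol at
`ξ` is `∫ u₀ (a^{1/2} r a^{1/2}) d_*a` over `εI < a < ρI`, where `r = (2π)² ξᵀξ`; by the symmetry
of `u₀` and the congruence invariance of `d_*` this is the integral of `u₀` over `εr < s < ρr`.

The image of `|z|_m⁻ⁿ dz` under `z ↦ zᵀz` is invariant under congruences of the cone, and such
measures are unique up to a factor; integrating a Gaussian shows that the factor is
`σ_{n,m} / 2^m`. Hence the symbol at `ξ` is `K(εr, ρr)`. It is uniformly bounded and tends to `c_ν`
almost everywhere, so Plancherel and dominated convergence give the limit in `L²`. -/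

namespace MatrixWavelet

/-! ### Positive definite matrices -/

section PositiveDefinite

variable {ι : Type*}

lemma isClosed_isHermitian : IsClosed {r : Matrix ι ι ℝ | r.IsHermitian} :=
  isClosed_eq (by fun_prop) continuous_id

lemma isClosed_posSemidef [Finite ι] : IsClosed {r : Matrix ι ι ℝ | r.PosSemidef} := by
  cases nonempty_fintype ι
  have setOf_eq : {r : Matrix ι ι ℝ | r.PosSemidef} =
      {r | r.IsHermitian} ∩ ⋂ x : ι → ℝ, {r | 0 ≤ x ⬝ᵥ (r *ᵥ x)} := by
    ext r
    simp [Matrix.posSemidef_iff_dotProduct_mulVec]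
  rw [setOf_eq]
  exact isClosed_isHermitian.inter
    (isClosed_iInter fun x => isClosed_le continuous_const (by fun_prop))

lemma abs_entry_le_trace [Fintype ι] {s : Matrix ι ι ℝ} (hs : s.PosSemidef) (i j : ι) :
    |s i j| ≤ s.trace := by
  classical
  have diag_nonneg : ∀ k, 0 ≤ s k k := fun k => hs.diag_nonneg
  have entry_symm : s j i = s i j := hs.isHermitian.apply i j
  obtain rfl | hij := eq_or_ne i j
  · rw [abs_of_nonneg (diag_nonneg i)]
    exact Finset.single_le_sum (f := fun k => s k k) (fun k _ => diag_nonneg k) (Finset.mem_univ i)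
  have diag_add_diag_le : s i i + s j j ≤ s.trace := by
    rw [← Finset.sum_pair hij (f := fun k => s k k)]
    exact Finset.sum_le_sum_of_subset_of_nonneg (Finset.subset_univ _) fun k _ _ => diag_nonneg k
  have quadratic_nonneg : ∀ c : ℝ, 0 ≤ s i i + 2 * c * s i j + c ^ 2 * s j j := fun c => by
    have h := hs.dotProduct_mulVec_nonneg (Pi.single i 1 + Pi.single j c)
    simp only [star_trivial, Matrix.mulVec_add, Matrix.mulVec_single, MulOpposite.op_one, one_smul,
      dotProduct_add, add_dotProduct, single_dotProduct, Matrix.col_apply, one_mul, Pi.smul_apply,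
      MulOpposite.smul_eq_mul_unop, MulOpposite.unop_op, entry_symm] at h
    linarith
  have := quadratic_nonneg 1
  have := quadratic_nonneg (-1)
  exact abs_le.2 ⟨by linarith [diag_nonneg i, diag_nonneg j],
    by linarith [diag_nonneg i, diag_nonneg j]⟩

open scoped MatrixOrder in
lemma posSemidef_sub_smul_one_iff [Fintype ι] [DecidableEq ι] {s : Matrix ι ι ℝ}
    (hs : s.IsHermitian) {δ : ℝ} :
    (s - δ • (1 : Matrix ι ι ℝ)).PosSemidef ↔ ∀ i, δ ≤ hs.eigenvalues i := by
  rw [← Matrix.nonneg_iff_posSemidef, sub_nonneg, ← Algebra.algebraMap_eq_smul_one,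
    algebraMap_le_iff_le_spectrum (a := s) hs, hs.spectrum_real_eq_range_eigenvalues,
    Set.forall_mem_range]

lemma exists_pos_posSemidef_sub [Finite ι] [DecidableEq ι] {s : Matrix ι ι ℝ} (hs : s.PosDef) :
    ∃ δ : ℝ, 0 < δ ∧ (s - δ • (1 : Matrix ι ι ℝ)).PosSemidef := by
  cases nonempty_fintype ι
  simp only [posSemidef_sub_smul_one_iff hs.isHermitian]
  cases isEmpty_or_nonempty ι with
  | inl _ => exact ⟨1, one_pos, isEmptyElim⟩
  | inr _ =>
    obtain ⟨i, hi⟩ := Finite.exists_min hs.isHermitian.eigenvalues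
    exact ⟨_, hs.eigenvalues_pos i, hi⟩

lemma pow_card_le_det [Fintype ι] [DecidableEq ι] {s : Matrix ι ι ℝ} {δ : ℝ} (hδ : 0 ≤ δ)
    (h : (s - δ • (1 : Matrix ι ι ℝ)).PosSemidef) : δ ^ Fintype.card ι ≤ s.det := by
  have hs : s.IsHermitian := by
    simpa using h.isHermitian.add ((Matrix.isHermitian_one (n := ι) (α := ℝ)).smul
      (IsSelfAdjoint.all δ))
  rw [hs.det_eq_prod_eigenvalues]
  calc δ ^ Fintype.card ι = ∏ _i : ι, δ := by simp
    _ ≤ ∏ i, hs.eigenvalues i :=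
      Finset.prod_le_prod (fun _ _ => hδ) fun i _ => (posSemidef_sub_smul_one_iff hs).1 h i

open scoped Matrix.Norms.L2Operator in
lemma posDef_add_smul_one_of_norm_lt [Fintype ι] [DecidableEq ι] {h : Matrix ι ι ℝ}
    (hh : h.IsHermitian) {δ : ℝ} (hδ : ‖h‖ < δ) : (h + δ • (1 : Matrix ι ι ℝ)).PosDef := by
  have posSemidef_add_norm : (h - (-‖h‖) • (1 : Matrix ι ι ℝ)).PosSemidef := by
    refine (posSemidef_sub_smul_one_iff hh).2 fun i => (abs_le.1 ?_).1
    have : Nonempty ι := ⟨i⟩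
    exact spectrum.norm_le_norm_of_mem (hh.eigenvalues_mem_spectrum_real i)
  have split : h + δ • (1 : Matrix ι ι ℝ) = (δ - ‖h‖) • 1 + (h - (-‖h‖) • 1) := by
    rw [sub_smul, neg_smul]; abel
  rw [split]
  exact (Matrix.PosDef.one.smul (sub_pos.2 hδ)).add_posSemidef posSemidef_add_norm

open scoped Matrix.Norms.L2Operator in
lemma eventually_posDef [Finite ι] {X : Type*} [TopologicalSpace X] {F : X → Matrix ι ι ℝ} {x : X}
    (hF : ContinuousAt F x) (hherm : ∀ᶠ y in 𝓝 x, (F y).IsHermitian) (hx : (F x).PosDef) :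
    ∀ᶠ y in 𝓝 x, (F y).PosDef := by
  classical
  cases nonempty_fintype ι
  obtain ⟨δ, hδ, hxδ⟩ := exists_pos_posSemidef_sub hx
  have norm_lt : ∀ᶠ y in 𝓝 x, ‖F y - F x‖ < δ := by
    refine (hF.sub continuousAt_const).norm.eventually (gt_mem_nhds ?_)
    simpa using hδ
  filter_upwards [norm_lt, hherm] with y hy hherm
  have := (posDef_add_smul_one_of_norm_lt (hherm.sub hx.isHermitian) hy).add_posSemidef hxδ
  rwa [show F y - F x + δ • (1 : Matrix ι ι ℝ) + (F x - δ • 1) = F y by abel] at this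

end PositiveDefinite

section Cone

variable {m : ℕ}

lemma measurableSet_cone : MeasurableSet (cone m) := by
  have cone_eq : cone m = {r | r.PosSemidef} ∩ {r | r.det ≠ 0} := by
    ext r
    exact ⟨fun h => ⟨h.posSemidef, h.det_pos.ne'⟩, fun h => h.1.posDef_iff_det_ne_zero.2 h.2⟩
  rw [cone_eq]
  exact isClosed_posSemidef.measurableSet.inter
    (isOpen_ne_fun (by fun_prop) continuous_const).measurableSet

lemma measurableSet_coneInterval (a b : Matrix (Fin m) (Fin m) ℝ) :
    MeasurableSet (coneInterval a b) :=
  ((continuous_id.sub continuous_const).measurable measurableSet_cone).inter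
    ((continuous_const.sub continuous_id).measurable measurableSet_cone)

lemma coneInterval_subset_cone {a b : Matrix (Fin m) (Fin m) ℝ} (ha : a.PosSemidef) :
    coneInterval a b ⊆ cone m := fun s hs => by
  have := hs.1.add_posSemidef ha
  rwa [sub_add_cancel] at this

lemma eventually_mem_coneInterval {X : Type*} [TopologicalSpace X]
    {F : X → Matrix (Fin m) (Fin m) ℝ} {x : X} {a b : Matrix (Fin m) (Fin m) ℝ}
    (hF : ContinuousAt F x) (hherm : ∀ y, (F y).IsHermitian) (hx : F x ∈ coneInterval a b) :
    ∀ᶠ y in 𝓝 x, F y ∈ coneInterval a b := by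
  have ha : a.IsHermitian := by simpa using (hherm x).sub hx.1.isHermitian
  have hb : b.IsHermitian := by simpa using (hherm x).add hx.2.isHermitian
  exact (eventually_posDef (hF.sub continuousAt_const) (.of_forall fun y => (hherm y).sub ha)
    hx.1).and (eventually_posDef (continuousAt_const.sub hF)
      (.of_forall fun y => hb.sub (hherm y)) hx.2)

lemma posDef_congr_iff {g : Matrix (Fin m) (Fin m) ℝ} (hg : IsUnit g.det)
    {s : Matrix (Fin m) (Fin m) ℝ} : (g * s * gᵀ).PosDef ↔ s.PosDef :=
  Matrix.IsUnit.posDef_star_right_conjugate_iff ((Matrix.isUnit_iff_isUnit_det g).2 hg)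

lemma coneInterval_congr {g : Matrix (Fin m) (Fin m) ℝ} (hg : IsUnit g.det)
    {a b s : Matrix (Fin m) (Fin m) ℝ} :
    g * s * gᵀ ∈ coneInterval (g * a * gᵀ) (g * b * gᵀ) ↔ s ∈ coneInterval a b := by
  simp only [coneInterval, Set.mem_ofPred_eq, ← Matrix.sub_mul, ← Matrix.mul_sub,
    posDef_congr_iff hg]

lemma tendsto_smul_coneNhdsZero {r : Matrix (Fin m) (Fin m) ℝ} (hr : r.PosDef) :
    Tendsto (fun ε : ℝ => ε • r) (𝓝[>] 0) (coneNhdsZero m) := by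
  refine tendsto_nhdsWithin_iff.2 ⟨?_, ?_⟩
  · have h := (show Continuous fun ε : ℝ => ε • r by fun_prop).tendsto 0
    rw [zero_smul] at h
    exact h.mono_left nhdsWithin_le_nhds
  · filter_upwards [self_mem_nhdsWithin] with ε hε
    exact hr.smul hε

lemma tendsto_smul_coneAtTop {r : Matrix (Fin m) (Fin m) ℝ} (hr : r.PosDef) :
    Tendsto (fun ρ : ℝ => ρ • r) atTop (coneAtTop m) := by
  obtain ⟨δ, hδ, h⟩ := exists_pos_posSemidef_sub hr
  refine tendsto_iInf.2 fun R => tendsto_principal.2 ?_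
  filter_upwards [eventually_gt_atTop 0, eventually_gt_atTop (R / δ)] with ρ hρ hRρ
  have split : ρ • r - R • (1 : Matrix (Fin m) (Fin m) ℝ) =
      (ρ * δ - R) • (1 : Matrix (Fin m) (Fin m) ℝ) + ρ • (r - δ • 1) := by
    rw [smul_sub, smul_smul, sub_smul]; abel
  rw [div_lt_iff₀ hδ] at hRρ
  refine ⟨hr.smul hρ, split ▸ ?_⟩
  exact (Matrix.PosDef.one.smul (sub_pos.2 hRρ)).add_posSemidef (h.smul hρ.le)

end Cone

section SquareRoot

variable {m : ℕ}

open scoped Matrix.Norms.L2Operator in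
lemma continuousOn_msqrt : ContinuousOn (msqrt (m := m)) {r | r.IsHermitian} :=
  ContinuousOn.cfc_of_mem_nhdsSet (A := Matrix (Fin m) (Fin m) ℝ) (p := IsSelfAdjoint) Real.sqrt
    univ_mem continuousOn_id (fun _ hr => hr) Real.continuous_sqrt.continuousOn

lemma measurable_msqrt : Measurable (msqrt (m := m)) := by
  classical
  have piecewise_eq :
      {r : Matrix (Fin m) (Fin m) ℝ | r.IsHermitian}.piecewise msqrt 0 = msqrt := by
    rw [Set.piecewise_eq_indicator, Set.indicator_eq_self]
    exact fun r hr => by_contra fun hherm => hr (cfc_apply_of_not_predicate r hherm)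
  rw [← piecewise_eq]
  exact continuousOn_msqrt.measurable_piecewise continuousOn_const
    isClosed_isHermitian.measurableSet

lemma transpose_msqrt (r : Matrix (Fin m) (Fin m) ℝ) : (msqrt r)ᵀ = msqrt r :=
  (cfc_predicate Real.sqrt r : IsSelfAdjoint (msqrt r))

open scoped MatrixOrder in
lemma msqrt_eq_cfcSqrt {r : Matrix (Fin m) (Fin m) ℝ} (hr : r.PosSemidef) :
    msqrt r = CFC.sqrt r :=
  ((CFC.sqrt_eq_real_sqrt r hr.nonneg).trans cfcₙ_eq_cfc).symm

open scoped MatrixOrder in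
lemma msqrt_mul_self {r : Matrix (Fin m) (Fin m) ℝ} (hr : r.PosSemidef) :
    msqrt r * msqrt r = r := by
  rw [msqrt_eq_cfcSqrt hr, CFC.sqrt_mul_sqrt_self r hr.nonneg]

lemma isUnit_det_msqrt {r : Matrix (Fin m) (Fin m) ℝ} (hr : r.PosDef) :
    IsUnit (msqrt r).det := by
  have h : (msqrt r).det * (msqrt r).det = r.det := by
    rw [← Matrix.det_mul, msqrt_mul_self hr.posSemidef]
  exact isUnit_of_mul_isUnit_left (h ▸ hr.det_pos.ne'.isUnit)

end SquareRoot

/-! ### Congruence-invariant measures -/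

instance (n m : ℕ) : (volume : Measure (Matrix (Fin n) (Fin m) ℝ)).IsAddHaarMeasure :=
  Measure.pi.isAddHaarMeasure (fun _ : Fin n => (volume : Measure (Fin m → ℝ)))

instance (n m : ℕ) : SigmaFinite (volume : Measure (Matrix (Fin n) (Fin m) ℝ)) :=
  inferInstanceAs (SigmaFinite (volume : Measure (Fin n → Fin m → ℝ)))

instance (n m : ℕ) : SecondCountableTopology (Matrix (Fin n) (Fin m) ℝ) :=
  inferInstanceAs (SecondCountableTopology (Fin n → Fin m → ℝ))

section SymmetricCoordinates

variable {m : ℕ}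

lemma isHermitian_symOfUpper (t : {p : Fin m × Fin m // p.1 ≤ p.2} → ℝ) :
    (symOfUpper t).IsHermitian := by
  ext i j
  simp [symOfUpper, min_comm, max_comm]

lemma continuous_symOfUpper : Continuous (symOfUpper (m := m)) := by
  unfold symOfUpper
  fun_prop

/-- The coordinates `s_{i,j}`, `i ≤ j`, of a matrix; on symmetric matrices this is the inverse of
`symOfUpper`. -/
def upperOfSym (s : Matrix (Fin m) (Fin m) ℝ) : {p : Fin m × Fin m // p.1 ≤ p.2} → ℝ :=
  fun p => s p.1.1 p.1.2

lemma upperOfSym_symOfUpper (t : {p : Fin m × Fin m // p.1 ≤ p.2} → ℝ) :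
    upperOfSym (symOfUpper t) = t := by
  ext ⟨⟨i, j⟩, h⟩
  simp only [upperOfSym, symOfUpper, Matrix.of_apply, min_eq_left h, max_eq_right h]

lemma symOfUpper_upperOfSym {s : Matrix (Fin m) (Fin m) ℝ} (hs : s.IsHermitian) :
    symOfUpper (upperOfSym s) = s := by
  ext i j
  rcases le_total i j with h | h
  · simp only [upperOfSym, symOfUpper, Matrix.of_apply, min_eq_left h, max_eq_right h]
  · simp only [upperOfSym, symOfUpper, Matrix.of_apply, min_eq_right h, max_eq_left h]
    exact hs.apply i j

lemma isHermitian_congr (g : Matrix (Fin m) (Fin m) ℝ) {s : Matrix (Fin m) (Fin m) ℝ}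
    (hs : s.IsHermitian) : (g * s * gᵀ).IsHermitian :=
  Matrix.isHermitian_mul_mul_conjTranspose g hs

/-- The representation of matrices `g` by the congruences `s ↦ g s gᵀ` of symmetric matrices `s`,
in the coordinates `s_{i,j}`, `i ≤ j`. -/
def congrUpper : Matrix (Fin m) (Fin m) ℝ →*
    Module.End ℝ ({p : Fin m × Fin m // p.1 ≤ p.2} → ℝ) where
  toFun g :=
    { toFun := fun t => upperOfSym (g * symOfUpper t * gᵀ)
      map_add' := fun s t => by
        rw [show symOfUpper (s + t) = symOfUpper s + symOfUpper t from rfl, Matrix.mul_add,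
          Matrix.add_mul]
        rfl
      map_smul' := fun c t => by
        rw [show symOfUpper (c • t) = c • symOfUpper t from rfl, Matrix.mul_smul, Matrix.smul_mul]
        rfl }
  map_one' := LinearMap.ext fun t => by simp [upperOfSym_symOfUpper]
  map_mul' g h := LinearMap.ext fun t => by
    simp only [Module.End.mul_apply, LinearMap.coe_mk, AddHom.coe_mk]
    rw [symOfUpper_upperOfSym (isHermitian_congr h (isHermitian_symOfUpper t)),
      Matrix.transpose_mul]
    simp only [Matrix.mul_assoc]

lemma symOfUpper_congrUpper (g : Matrix (Fin m) (Fin m) ℝ)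
    (t : {p : Fin m × Fin m // p.1 ≤ p.2} → ℝ) :
    symOfUpper (congrUpper g t) = g * symOfUpper t * gᵀ :=
  symOfUpper_upperOfSym (isHermitian_congr g (isHermitian_symOfUpper t))

end SymmetricCoordinates

section CongruenceDeterminant

/-- If `D` is diagonal with a single entry `2` in position `i`, then `D T(c) = T(c) T(c) D` for the
transvections `T(c)`, so `φ (T(c)) = 1` after cancelling units of the commutative monoid. -/
lemma map_transvection_eq_one {ι K M : Type*} [Fintype ι] [DecidableEq ι] [Field K]
    [NeZero (2 : K)] [CommMonoid M] (φ : Matrix ι ι K →* M) {i j : ι} (hij : i ≠ j) (c : K) :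
    φ (Matrix.transvection i j c) = 1 := by
  set D : Matrix ι ι K := Matrix.diagonal (Function.update 1 i 2)
  set T := Matrix.transvection i j c
  have hT : IsUnit (φ T) := ((Matrix.isUnit_iff_isUnit_det T).2
    (by simp [T, Matrix.det_transvection_of_ne i j hij])).map φ
  have hD : IsUnit (φ D) := by
    refine ((Matrix.isUnit_iff_isUnit_det D).2 ?_).map φ
    rw [Matrix.det_diagonal, isUnit_iff_ne_zero, Finset.prod_ne_zero_iff]
    intro k _
    obtain rfl | hk := eq_or_ne k i <;> simp [*, NeZero.ne]
  have commutation : D * T = T * T * D := by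
    rw [Matrix.transvection_mul_transvection_same i j hij]
    simp only [T, Matrix.transvection, Matrix.mul_add, Matrix.add_mul, Matrix.mul_one,
      Matrix.one_mul]
    congr 1
    ext k l
    rw [Matrix.mul_diagonal, Matrix.diagonal_mul]
    by_cases hkl : i = k ∧ j = l
    · obtain ⟨rfl, rfl⟩ := hkl
      simp [hij.symm, two_mul]
    · simp [Matrix.single_apply_of_ne _ _ _ _ _ hkl]
  have h := congrArg φ commutation
  rw [map_mul, map_mul, map_mul, mul_comm, hD.mul_left_inj] at h
  exact (hT.mul_eq_left).1 h.symm

lemma prod_mul_upper {R : Type*} [CommMonoid R] {m : ℕ} (d : Fin m → R) :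
    ∏ p : {p : Fin m × Fin m // p.1 ≤ p.2}, d p.1.1 * d p.1.2 = (∏ i, d i) ^ (m + 1) := by
  have prod_upper (F : Fin m × Fin m → R) :
      ∏ p : {p : Fin m × Fin m // p.1 ≤ p.2}, F p.1 = ∏ i, ∏ j, if i ≤ j then F (i, j) else 1 := by
    rw [← Fintype.prod_prod_type' (f := fun i j => if i ≤ j then F (i, j) else 1),
      ← Finset.prod_filter]
    exact (Finset.prod_subtype _ (by simp) F).symm
  rw [Finset.prod_mul_distrib, prod_upper fun p => d p.1, prod_upper fun p => d p.2]
  dsimp only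
  rw [Finset.prod_comm (f := fun i j => if i ≤ j then d j else 1), ← Finset.prod_mul_distrib,
    ← Finset.prod_pow]
  refine Finset.prod_congr rfl fun i _ => ?_
  rw [← Finset.prod_filter, ← Finset.prod_filter, Finset.filter_le_eq_Ici, Finset.filter_ge_eq_Iic,
    Finset.prod_const, Finset.prod_const, Fin.card_Ici, Fin.card_Iic, ← pow_add]
  congr 1
  omega

variable {m : ℕ}

lemma det_congrUpper_diagonal (d : Fin m → ℝ) :
    LinearMap.det (congrUpper (Matrix.diagonal d)) = (∏ i, d i) ^ (m + 1) := by
  have eq_toLin : congrUpper (Matrix.diagonal d) =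
      Matrix.toLin' (Matrix.diagonal fun p : {p : Fin m × Fin m // p.1 ≤ p.2} =>
        d p.1.1 * d p.1.2) := by
    refine LinearMap.ext fun t => funext fun p => ?_
    have symOfUpper_apply : symOfUpper t p.1.1 p.1.2 = t p := congrFun (upperOfSym_symOfUpper t) p
    change (Matrix.diagonal d * symOfUpper t * (Matrix.diagonal d)ᵀ) p.1.1 p.1.2 = _
    simp only [Matrix.diagonal_transpose, Matrix.mul_diagonal, Matrix.diagonal_mul,
      symOfUpper_apply, Matrix.toLin'_apply, Matrix.mulVec_diagonal]
    ring
  rw [eq_toLin, LinearMap.det_toLin', Matrix.det_diagonal, prod_mul_upper]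

lemma det_congrUpper {g : Matrix (Fin m) (Fin m) ℝ} (hg : g.det ≠ 0) :
    LinearMap.det (congrUpper g) = g.det ^ (m + 1) := by
  refine Matrix.diagonal_transvection_induction_of_det_ne_zero
    (fun g => LinearMap.det (congrUpper g) = g.det ^ (m + 1)) g hg (fun D _ => ?_) (fun t => ?_)
    (fun A B _ _ hA hB => ?_)
  · rw [det_congrUpper_diagonal, Matrix.det_diagonal]
  · rw [Matrix.TransvectionStruct.det, one_pow]
    exact map_transvection_eq_one (LinearMap.det.comp congrUpper) t.hij t.c
  · rw [map_mul, map_mul, hA, hB, Matrix.det_mul, mul_pow]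

end CongruenceDeterminant

section Invariance

variable {m : ℕ}

lemma measurable_congr (g : Matrix (Fin m) (Fin m) ℝ) :
    Measurable fun s : Matrix (Fin m) (Fin m) ℝ => g * s * gᵀ :=
  Continuous.measurable (by fun_prop)

lemma map_congr_lebSym {g : Matrix (Fin m) (Fin m) ℝ} (hg : g.det ≠ 0) :
    (lebSym m).map (fun s => g * s * gᵀ) =
      ENNReal.ofReal (|g.det| ^ (m + 1))⁻¹ • lebSym m := by
  have hdet : LinearMap.det (congrUpper g) ≠ 0 := det_congrUpper hg ▸ pow_ne_zero _ hg
  have intertwine : (fun s : Matrix (Fin m) (Fin m) ℝ => g * s * gᵀ) ∘ symOfUpper =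
      symOfUpper ∘ congrUpper g :=
    funext fun t => (symOfUpper_congrUpper g t).symm
  rw [lebSym, Measure.map_map (measurable_congr g) continuous_symOfUpper.measurable, intertwine,
    ← Measure.map_map continuous_symOfUpper.measurable
      (LinearMap.continuous_of_finiteDimensional _).measurable,
    Measure.map_linearMap_addHaar_eq_smul_addHaar _ hdet, Measure.map_smul, det_congrUpper hg,
    abs_inv, abs_pow]

lemma map_withDensity_eq_self {α : Type*} [MeasurableSpace α] {μ : Measure α} {φ : α → α}
    (hφ : Measurable φ) {w : α → ENNReal} (hw : Measurable w) {c c' : ENNReal}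
    (hμ : μ.map φ = c • μ) (hwφ : ∀ᵐ x ∂μ, w x = c' * w (φ x)) (hc : c' * c = 1) :
    (μ.withDensity w).map φ = μ.withDensity w := by
  ext A hA
  rw [Measure.map_apply hφ hA, withDensity_apply _ (hφ hA), withDensity_apply _ hA]
  calc ∫⁻ x in φ ⁻¹' A, w x ∂μ = ∫⁻ x in φ ⁻¹' A, c' * w (φ x) ∂μ :=
        lintegral_congr_ae (ae_restrict_of_ae hwφ)
    _ = c' * ∫⁻ x in A, w x ∂(μ.map φ) := by
        rw [lintegral_const_mul c' (f := fun x => w (φ x)) (hw.comp hφ),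
          setLIntegral_map hA hw hφ]
    _ = ∫⁻ x in A, w x ∂μ := by
        rw [hμ, Measure.restrict_smul, lintegral_smul_measure, smul_eq_mul, ← mul_assoc, hc,
          one_mul]

/-- A measure on square matrices is congruence invariant if it is preserved by all maps
`s ↦ g s gᵀ` with `g` invertible. -/
def IsCongrInvariant (μ : Measure (Matrix (Fin m) (Fin m) ℝ)) : Prop :=
  ∀ g : Matrix (Fin m) (Fin m) ℝ, IsUnit g.det → μ.map (fun s => g * s * gᵀ) = μ

lemma IsCongrInvariant.lintegral_comp {μ : Measure (Matrix (Fin m) (Fin m) ℝ)}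
    (hμ : IsCongrInvariant μ) {g : Matrix (Fin m) (Fin m) ℝ} (hg : IsUnit g.det)
    {f : Matrix (Fin m) (Fin m) ℝ → ENNReal} (hf : Measurable f) :
    ∫⁻ s, f (g * s * gᵀ) ∂μ = ∫⁻ s, f s ∂μ := by
  conv_rhs => rw [← hμ g hg]
  rw [lintegral_map hf (measurable_congr g)]

lemma measurable_det_rpow (c : ℝ) :
    Measurable fun r : Matrix (Fin m) (Fin m) ℝ => ENNReal.ofReal (r.det ^ c) := by
  have continuous_det : Continuous fun r : Matrix (Fin m) (Fin m) ℝ => r.det := by fun_prop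
  exact (continuous_det.measurable.pow_const c).ennreal_ofReal

lemma det_congr (g s : Matrix (Fin m) (Fin m) ℝ) : (g * s * gᵀ).det = |g.det| ^ 2 * s.det := by
  rw [Matrix.det_mul, Matrix.det_mul, Matrix.det_transpose, sq_abs]
  ring

lemma ae_restrict_cone_posDef (μ : Measure (Matrix (Fin m) (Fin m) ℝ)) :
    ∀ᵐ s ∂(μ.restrict (cone m)), s.PosDef :=
  ae_restrict_mem measurableSet_cone

lemma ae_dStar_posDef : ∀ᵐ s ∂(dStar m), s.PosDef :=
  (withDensity_absolutelyContinuous _ _).ae_le (ae_restrict_cone_posDef _)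

lemma isCongrInvariant_dStar : IsCongrInvariant (dStar m) := by
  intro g hg
  have hg0 : 0 < |g.det| := abs_pos.2 hg.ne_zero
  refine map_withDensity_eq_self (measurable_congr g) (measurable_det_rpow _)
    (c := ENNReal.ofReal (|g.det| ^ (m + 1))⁻¹) (c' := ENNReal.ofReal (|g.det| ^ (m + 1))) ?_ ?_ ?_
  · have preimage_cone : (fun s => g * s * gᵀ) ⁻¹' cone m = cone m :=
      Set.ext fun s => posDef_congr_iff hg
    have h := Measure.restrict_map (μ := lebSym m) (measurable_congr g) measurableSet_cone
    rw [map_congr_lebSym hg.ne_zero, preimage_cone, Measure.restrict_smul] at h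
    exact h.symm
  · filter_upwards [ae_restrict_cone_posDef (lebSym m)] with s hs
    have exponent : (m : ℝ) + 1 + 2 * -(((m : ℝ) + 1) / 2) = 0 := by ring
    rw [det_congr, Real.mul_rpow (by positivity) hs.det_pos.le,
      ← ENNReal.ofReal_mul (by positivity), ← mul_assoc, ← Real.rpow_natCast,
      ← Real.rpow_natCast, ← Real.rpow_mul hg0.le, ← Real.rpow_add hg0]
    push_cast
    rw [exponent, Real.rpow_zero, one_mul]
  · rw [← ENNReal.ofReal_mul (by positivity), mul_inv_cancel₀ (by positivity), ENNReal.ofReal_one]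

end Invariance

/-! ### The image of `|z|_m⁻ⁿ dz` under `z ↦ zᵀz` -/

section Gram

variable {n m : ℕ}

lemma continuous_matVol : Continuous (matVol (n := n) (m := m)) := by
  unfold matVol
  fun_prop

lemma matVol_nonneg (z : Matrix (Fin n) (Fin m) ℝ) : 0 ≤ matVol z := Real.sqrt_nonneg _

lemma gram_mul_transpose (z : Matrix (Fin n) (Fin m) ℝ) (g : Matrix (Fin m) (Fin m) ℝ) :
    (z * gᵀ)ᵀ * (z * gᵀ) = g * (zᵀ * z) * gᵀ := by
  simp only [Matrix.transpose_mul, Matrix.transpose_transpose, Matrix.mul_assoc]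

lemma matVol_mul_transpose (z : Matrix (Fin n) (Fin m) ℝ) (g : Matrix (Fin m) (Fin m) ℝ) :
    matVol (z * gᵀ) = |g.det| * matVol z := by
  rw [matVol, gram_mul_transpose, det_congr, Real.sqrt_mul (sq_nonneg _),
    Real.sqrt_sq (abs_nonneg _), matVol]

lemma gram_posSemidef (z : Matrix (Fin n) (Fin m) ℝ) : (zᵀ * z).PosSemidef :=
  Matrix.posSemidef_conjTranspose_mul_self z

lemma gram_posDef_iff {z : Matrix (Fin n) (Fin m) ℝ} : (zᵀ * z).PosDef ↔ matVol z ≠ 0 := by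
  rw [(gram_posSemidef z).posDef_iff_det_ne_zero, matVol, ne_eq, ne_eq,
    Real.sqrt_eq_zero (gram_posSemidef z).det_nonneg]

lemma isUnit_det_of_gram_posDef {g : Matrix (Fin m) (Fin m) ℝ} (hg : (gᵀ * g).PosDef) :
    IsUnit g.det := by
  have h := hg.det_pos
  rw [Matrix.det_mul, Matrix.det_transpose] at h
  exact (mul_self_pos.1 h).isUnit

/-- The matrix of the inclusion of `ℝᵐ` in `ℝⁿ` on the first `m` coordinates, for `m ≤ n`. -/
def stdEmb (n m : ℕ) : Matrix (Fin n) (Fin m) ℝ :=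
  Matrix.of fun i j => if i.val = j.val then 1 else 0

lemma gram_stdEmb (hmn : m ≤ n) : (stdEmb n m)ᵀ * stdEmb n m = 1 := by
  ext i j
  simp only [stdEmb, Matrix.mul_apply, Matrix.transpose_apply, Matrix.of_apply]
  rw [Finset.sum_eq_single (Fin.castLE hmn i) (fun k _ hk => ?_) (by simp)]
  · simp [Matrix.one_apply, Fin.ext_iff]
  · have : k.val ≠ i.val := fun h => hk (Fin.ext h)
    rw [if_neg this, zero_mul]

end Gram

section GramMeasure

variable {n m : ℕ}

lemma map_mul_transpose_volume (n : ℕ) {g : Matrix (Fin m) (Fin m) ℝ} (hg : g.det ≠ 0) :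
    (volume : Measure (Matrix (Fin n) (Fin m) ℝ)).map (fun z => z * gᵀ) =
      ENNReal.ofReal (|g.det| ^ n)⁻¹ • volume := by
  set L : (Fin n → Fin m → ℝ) →ₗ[ℝ] (Fin n → Fin m → ℝ) :=
    LinearMap.pi fun i => Matrix.toLin' g ∘ₗ LinearMap.proj i with hL
  have det_eq : LinearMap.det L = g.det ^ n := by
    rw [hL, LinearMap.det_pi]
    simp
  have mul_eq : (fun z : Matrix (Fin n) (Fin m) ℝ => z * gᵀ) = L := by
    funext z i j
    change _ = (g *ᵥ z i) j
    simp only [Matrix.mul_apply, Matrix.transpose_apply, Matrix.mulVec, dotProduct, mul_comm]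
  have h := Measure.map_linearMap_addHaar_eq_smul_addHaar
    (volume : Measure (Fin n → Fin m → ℝ)) (f := L) (det_eq ▸ pow_ne_zero _ hg)
  rw [det_eq, abs_inv, abs_pow] at h
  rw [mul_eq]
  exact h

/-- The measure `|z|_m⁻ⁿ dz` on `n × m` matrices, invariant under `GL_m` acting on the right; for
`n = m` it is a Haar measure of `GL_m`. -/
noncomputable def invVolume (n m : ℕ) : Measure (Matrix (Fin n) (Fin m) ℝ) :=
  volume.withDensity fun z => ENNReal.ofReal (matVol z ^ n)⁻¹

lemma measurable_invVolume_density :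
    Measurable fun z : Matrix (Fin n) (Fin m) ℝ => ENNReal.ofReal (matVol z ^ n)⁻¹ :=
  ((continuous_matVol.pow n).measurable.inv).ennreal_ofReal

lemma measurable_mul_right {l : ℕ} (g : Matrix (Fin m) (Fin l) ℝ) :
    Measurable fun z : Matrix (Fin n) (Fin m) ℝ => z * g :=
  Continuous.measurable (by fun_prop)

lemma measurable_gram : Measurable fun z : Matrix (Fin n) (Fin m) ℝ => zᵀ * z :=
  Continuous.measurable (by fun_prop)

lemma map_mul_transpose_invVolume (n : ℕ) {g : Matrix (Fin m) (Fin m) ℝ} (hg : IsUnit g.det) :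
    (invVolume n m).map (fun z => z * gᵀ) = invVolume n m := by
  have hg0 : 0 < |g.det| := abs_pos.2 hg.ne_zero
  refine map_withDensity_eq_self (measurable_mul_right _) measurable_invVolume_density
    (map_mul_transpose_volume n hg.ne_zero) (c' := ENNReal.ofReal (|g.det| ^ n))
    (.of_forall fun z => ?_) ?_
  · rw [matVol_mul_transpose, ← ENNReal.ofReal_mul (by positivity), mul_pow, mul_inv, ← mul_assoc,
      mul_inv_cancel₀ (by positivity), one_mul]
  · rw [← ENNReal.ofReal_mul (by positivity), mul_inv_cancel₀ (by positivity), ENNReal.ofReal_one]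

lemma lintegral_invVolume_mul_transpose {g : Matrix (Fin m) (Fin m) ℝ} (hg : IsUnit g.det)
    {f : Matrix (Fin n) (Fin m) ℝ → ENNReal} (hf : Measurable f) :
    ∫⁻ z, f (z * gᵀ) ∂(invVolume n m) = ∫⁻ z, f z ∂(invVolume n m) := by
  rw [← lintegral_map hf (measurable_mul_right _), map_mul_transpose_invVolume n hg]

lemma ae_invVolume_posDef (hn : n ≠ 0) : ∀ᵐ z ∂(invVolume n m), (zᵀ * z).PosDef := by
  rw [invVolume, ae_withDensity_iff measurable_invVolume_density]
  refine Eventually.of_forall fun z hz => gram_posDef_iff.2 fun h0 => hz ?_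
  rw [h0, zero_pow hn, inv_zero, ENNReal.ofReal_zero]

/-- The image of `|z|_m⁻ⁿ dz` under `z ↦ zᵀz`. -/
noncomputable def gramMeasure (n m : ℕ) : Measure (Matrix (Fin m) (Fin m) ℝ) :=
  (invVolume n m).map fun z => zᵀ * z

instance : SFinite (invVolume n m) := by
  unfold invVolume
  infer_instance

instance : SFinite (gramMeasure n m) := by
  unfold gramMeasure
  infer_instance

instance : SFinite (dStar m) := by
  unfold dStar lebSym
  infer_instance

lemma ae_gramMeasure_posDef (hn : n ≠ 0) : ∀ᵐ s ∂(gramMeasure n m), s.PosDef :=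
  (ae_map_iff measurable_gram.aemeasurable measurableSet_cone).2 (ae_invVolume_posDef hn)

lemma isCongrInvariant_gramMeasure : IsCongrInvariant (gramMeasure n m) := by
  intro g hg
  have intertwine : (fun s => g * s * gᵀ) ∘ (fun z : Matrix (Fin n) (Fin m) ℝ => zᵀ * z) =
      (fun z => zᵀ * z) ∘ fun z => z * gᵀ :=
    funext fun z => (gram_mul_transpose z g).symm
  rw [gramMeasure, Measure.map_map (measurable_congr g) measurable_gram, intertwine,
    ← Measure.map_map measurable_gram (measurable_mul_right _), map_mul_transpose_invVolume n hg]

end GramMeasure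

section Finiteness

variable {m : ℕ}

lemma lebSym_lt_top_of_abs_entry_le {A : Set (Matrix (Fin m) (Fin m) ℝ)} {R : ℝ}
    (hA : ∀ s ∈ A, ∀ i j, |s i j| ≤ R) : lebSym m A < ⊤ := by
  set B : Set (Matrix (Fin m) (Fin m) ℝ) := {s | ∀ i j, |s i j| ≤ R}
  have hB : MeasurableSet B := by
    simp only [B, Set.ofPred_forall]
    exact (isClosed_iInter fun i => isClosed_iInter fun j =>
      isClosed_le (by fun_prop) continuous_const).measurableSet
  refine (measure_mono hA : lebSym m A ≤ lebSym m B).trans_lt ?_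
  rw [lebSym, Measure.map_apply continuous_symOfUpper.measurable hB]
  refine (measure_mono fun t ht => ?_).trans_lt
    (measure_Icc_lt_top (a := fun _ => -R) (b := fun _ => R))
  have abs_le_R (p) : |t p| ≤ R := by
    rw [← upperOfSym_symOfUpper t]
    exact ht _ _
  exact ⟨fun p => (abs_le.1 (abs_le_R p)).1, fun p => (abs_le.1 (abs_le_R p)).2⟩

lemma dStar_coneInterval_lt_top {a b : Matrix (Fin m) (Fin m) ℝ} (ha : a.PosDef) :
    dStar m (coneInterval a b) < ⊤ := by
  obtain ⟨δ, hδ, haδ⟩ := exists_pos_posSemidef_sub ha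
  have hmeas := measurableSet_coneInterval a b
  rw [dStar, withDensity_apply _ hmeas, Measure.restrict_restrict hmeas]
  have density_le : ∀ s ∈ coneInterval a b ∩ cone m,
      ENNReal.ofReal (s.det ^ (-(((m : ℝ) + 1) / 2))) ≤
        ENNReal.ofReal ((δ ^ Fintype.card (Fin m)) ^ (-(((m : ℝ) + 1) / 2))) := by
    intro s hs
    have hsδ : (s - δ • (1 : Matrix (Fin m) (Fin m) ℝ)).PosSemidef := by
      simpa using hs.1.1.posSemidef.add haδ
    refine ENNReal.ofReal_le_ofReal (Real.rpow_le_rpow_of_nonpos (by positivity)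
      (pow_card_le_det hδ.le hsδ) ?_)
    rw [neg_nonpos]
    positivity
  have abs_entry_le : ∀ s ∈ coneInterval a b ∩ cone m, ∀ i j, |s i j| ≤ b.trace := by
    intro s hs i j
    have trace_le := hs.1.2.posSemidef.trace_nonneg
    rw [Matrix.trace_sub, sub_nonneg] at trace_le
    exact (abs_entry_le_trace hs.2.posSemidef i j).trans trace_le
  refine (setLIntegral_mono' (hmeas.inter measurableSet_cone) density_le).trans_lt ?_
  rw [setLIntegral_const]
  exact ENNReal.mul_lt_top ENNReal.ofReal_lt_top (lebSym_lt_top_of_abs_entry_le abs_entry_le)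

end Finiteness

/-! ### Polar decomposition -/

section FullRank

variable {n m : ℕ}

lemma finite_setOf_matVol_smul_add_eq_zero {w : Matrix (Fin n) (Fin m) ℝ} (hw : matVol w ≠ 0)
    (z : Matrix (Fin n) (Fin m) ℝ) : {t : ℝ | matVol (t • z + w) = 0}.Finite := by
  set P : Matrix (Fin n) (Fin m) (Polynomial ℝ) :=
    (Polynomial.X : Polynomial ℝ) • z.map Polynomial.C + w.map Polynomial.C
  set Q : Polynomial ℝ := (Pᵀ * P).det
  have eval_Q (t : ℝ) : Q.eval t = ((t • z + w)ᵀ * (t • z + w)).det := by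
    have eval_P : P.map (Polynomial.evalRingHom t) = t • z + w := by
      ext i j
      simp only [P, Matrix.map_apply, Matrix.add_apply, Matrix.smul_apply, smul_eq_mul,
        Polynomial.coe_evalRingHom, Polynomial.eval_add, Polynomial.eval_mul, Polynomial.eval_X,
        Polynomial.eval_C]
    rw [← Polynomial.coe_evalRingHom, RingHom.map_det, RingHom.mapMatrix_apply, Matrix.map_mul,
      Matrix.transpose_map, eval_P]
  have matVol_eq (t : ℝ) : matVol (t • z + w) = √(Q.eval t) := by rw [eval_Q, matVol]
  have Q_ne_zero : Q ≠ 0 := fun h => hw <| by simpa [h] using matVol_eq 0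
  refine (Polynomial.finite_setOfPred_isRoot Q_ne_zero).subset fun t ht => ?_
  rw [Set.mem_ofPred_eq, matVol_eq, Real.sqrt_eq_zero] at ht
  · exact ht
  · exact eval_Q t ▸ (gram_posSemidef _).det_nonneg

lemma ae_matVol_ne_zero (hmn : m ≤ n) : ∀ᵐ z : Matrix (Fin n) (Fin m) ℝ, matVol z ≠ 0 := by
  have matVol_stdEmb : matVol (stdEmb n m) ≠ 0 :=
    gram_posDef_iff.1 (gram_stdEmb hmn ▸ Matrix.PosDef.one)
  have hmeas : MeasurableSet {p : ℝ × Matrix (Fin n) (Fin m) ℝ |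
      matVol (p.1 • p.2 + stdEmb n m) ≠ 0} :=
    (isOpen_ne_fun (continuous_matVol.comp (by fun_prop)) continuous_const).measurableSet
  have ae_line : ∀ᵐ t : ℝ, ∀ᵐ z : Matrix (Fin n) (Fin m) ℝ, matVol (t • z + stdEmb n m) ≠ 0 :=
    (Measure.ae_ae_comm hmeas).2 <| .of_forall fun z => by
      rw [ae_iff]
      simpa only [not_not] using
        (finite_setOf_matVol_smul_add_eq_zero matVol_stdEmb z).measure_zero volume
  obtain ⟨t, ht, ht0⟩ := (ae_line.and (Measure.ae_ne volume 0)).exists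
  rw [ae_iff] at ht ⊢
  set N : Set (Matrix (Fin n) (Fin m) ℝ) := {z | ¬ matVol z ≠ 0}
  have null_smul : volume ((fun z : Matrix (Fin n) (Fin m) ℝ => t • z) ⁻¹'
      ((fun z => z + stdEmb n m) ⁻¹' N)) = 0 := ht
  have h := Measure.addHaar_preimage_smul (volume : Measure (Fin n → Fin m → ℝ)) ht0
    ((fun z : Matrix (Fin n) (Fin m) ℝ => z + stdEmb n m) ⁻¹' N)
  rw [← measure_preimage_add_right volume (stdEmb n m)]
  refine (mul_eq_zero.1 (h.symm.trans null_smul)).resolve_left ?_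
  simp [ht0]

end FullRank

section Gaussian

variable {n m : ℕ}

/-- Matrices as vectors of a Euclidean space, with the Frobenius inner product. -/
noncomputable def matEuclid (n m : ℕ) :
    Matrix (Fin n) (Fin m) ℝ ≃ₜ EuclideanSpace ℝ (Fin n × Fin m) where
  toFun z := WithLp.toLp 2 fun p => z p.1 p.2
  invFun v := Matrix.of fun i j => v (i, j)
  left_inv _ := rfl
  right_inv _ := rfl
  continuous_toFun := by fun_prop
  continuous_invFun := by fun_prop

lemma inner_matEuclid (x y : Matrix (Fin n) (Fin m) ℝ) :
    inner ℝ (matEuclid n m x) (matEuclid n m y) = (yᵀ * x).trace := by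
  change inner ℝ (WithLp.toLp 2 _) (WithLp.toLp 2 _) = _
  rw [EuclideanSpace.inner_toLp_toLp]
  simp only [dotProduct, Matrix.trace, Matrix.diag, Matrix.mul_apply, Matrix.transpose_apply,
    Pi.star_apply, star_trivial, Fintype.sum_prod_type]
  rw [Finset.sum_comm]

lemma measurePreserving_uncurry (n m : ℕ) :
    MeasurePreserving fun (z : Matrix (Fin n) (Fin m) ℝ) (p : Fin n × Fin m) => z p.1 p.2 := by
  have hmeas : Measurable fun (z : Matrix (Fin n) (Fin m) ℝ) (p : Fin n × Fin m) => z p.1 p.2 :=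
    Continuous.measurable (by fun_prop)
  refine ⟨hmeas, (Measure.pi_eq fun s hs => ?_).symm⟩
  have preimage_eq : (fun (z : Matrix (Fin n) (Fin m) ℝ) (p : Fin n × Fin m) => z p.1 p.2) ⁻¹'
      Set.univ.pi s = (Set.univ.pi fun i => Set.univ.pi fun j => s (i, j) :
        Set (Fin n → Fin m → ℝ)) := by
    ext z
    exact ⟨fun h i _ j _ => h (i, j) trivial, fun h p _ => h p.1 trivial p.2 trivial⟩
  rw [Measure.map_apply hmeas (MeasurableSet.univ_pi hs), preimage_eq]
  change (volume : Measure (Fin n → Fin m → ℝ)) _ = _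
  simp only [volume_pi_pi, Fintype.prod_prod_type]

lemma measurePreserving_matEuclid : MeasurePreserving (matEuclid n m) :=
  (PiLp.volume_preserving_toLp (Fin n × Fin m)).comp (measurePreserving_uncurry n m)

lemma integral_exp_neg_trace_gram :
    ∫ z : Matrix (Fin n) (Fin m) ℝ, Real.exp (-(zᵀ * z).trace) =
      Real.pi ^ ((n : ℝ) * m / 2) := by
  have h := GaussianFourier.integral_rexp_neg_mul_sq_norm
    (V := EuclideanSpace ℝ (Fin n × Fin m)) one_pos
  rw [← (measurePreserving_matEuclid (n := n) (m := m)).integral_comp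
    (matEuclid n m).measurableEmbedding] at h
  simp only [← inner_matEuclid, real_inner_self_eq_norm_sq]
  simpa using h

lemma lintegral_exp_neg_trace_gram :
    ∫⁻ z : Matrix (Fin n) (Fin m) ℝ, ENNReal.ofReal (Real.exp (-(zᵀ * z).trace)) =
      ENNReal.ofReal (Real.pi ^ ((n : ℝ) * m / 2)) := by
  rw [← integral_exp_neg_trace_gram, ofReal_integral_eq_lintegral_ofReal]
  · refine Integrable.of_integral_ne_zero ?_
    rw [integral_exp_neg_trace_gram]
    positivity
  · exact .of_forall fun z => (Real.exp_pos _).le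

/-- The function `e^{-tr s} det(s)^α`, whose integral over the cone against the invariant measure
is `Γ_m(α)`. -/
noncomputable def siegelIntegrand (α : ℝ) (s : Matrix (Fin m) (Fin m) ℝ) : ℝ :=
  Real.exp (-s.trace) * s.det ^ α

lemma measurable_siegelIntegrand (α : ℝ) : Measurable (siegelIntegrand (m := m) α) := by
  have continuous_trace : Continuous fun s : Matrix (Fin m) (Fin m) ℝ => s.trace := by fun_prop
  have continuous_det : Continuous fun s : Matrix (Fin m) (Fin m) ℝ => s.det := by fun_prop
  exact (Real.measurable_exp.comp continuous_trace.measurable.neg).mul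
    (continuous_det.measurable.pow_const α)

lemma siegelIntegrand_mul_transpose (α : ℝ) (g : Matrix (Fin m) (Fin m) ℝ) :
    siegelIntegrand α (g * gᵀ) = siegelIntegrand α (gᵀ * g) := by
  rw [siegelIntegrand, siegelIntegrand, Matrix.trace_mul_comm, Matrix.det_mul_comm]

lemma lintegral_dStar_siegelIntegrand (m : ℕ) (α : ℝ) :
    ∫⁻ s, ENNReal.ofReal (siegelIntegrand α s) ∂(dStar m) =
      ∫⁻ s in cone m, ENNReal.ofReal (siegelIntegrand (α - ((m : ℝ) + 1) / 2) s) ∂(lebSym m) := by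
  rw [dStar, lintegral_withDensity_eq_lintegral_mul _ (measurable_det_rpow _)
    (measurable_siegelIntegrand α).ennreal_ofReal]
  refine setLIntegral_congr_fun measurableSet_cone fun s hs => ?_
  have det_pos : 0 < s.det := Matrix.PosDef.det_pos hs
  rw [Pi.mul_apply, ← ENNReal.ofReal_mul (by positivity), siegelIntegrand, siegelIntegrand,
    mul_left_comm, ← Real.rpow_add det_pos, neg_add_eq_sub]

lemma siegelGamma_eq_toReal (m : ℕ) (α : ℝ) :
    siegelGamma m α = (∫⁻ s, ENNReal.ofReal (siegelIntegrand α s) ∂(dStar m)).toReal := by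
  rw [lintegral_dStar_siegelIntegrand, siegelGamma, integral_eq_lintegral_of_nonneg_ae]
  · rfl
  · filter_upwards [ae_restrict_cone_posDef (lebSym m)] with s hs
    have := hs.det_pos
    rw [Pi.zero_apply]
    positivity
  · exact (measurable_siegelIntegrand _).aestronglyMeasurable

lemma lintegral_gramMeasure_siegelIntegrand (hmn : m ≤ n) :
    ∫⁻ s, ENNReal.ofReal (siegelIntegrand ((n : ℝ) / 2) s) ∂(gramMeasure n m) =
      ENNReal.ofReal (Real.pi ^ ((n : ℝ) * m / 2)) := by
  have hmeas := (measurable_siegelIntegrand (m := m) ((n : ℝ) / 2)).ennreal_ofReal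
  have hgram : Measurable fun z : Matrix (Fin n) (Fin m) ℝ =>
      ENNReal.ofReal (siegelIntegrand ((n : ℝ) / 2) (zᵀ * z)) := hmeas.comp measurable_gram
  rw [gramMeasure, lintegral_map hmeas measurable_gram, invVolume,
    lintegral_withDensity_eq_lintegral_mul _ measurable_invVolume_density hgram,
    ← lintegral_exp_neg_trace_gram]
  refine lintegral_congr_ae ((ae_matVol_ne_zero hmn).mono fun z hz => ?_)
  have matVol_pow : (zᵀ * z).det ^ ((n : ℝ) / 2) = matVol z ^ n := by
    rw [matVol, Real.sqrt_eq_rpow, ← Real.rpow_mul_natCast (gram_posSemidef z).det_nonneg,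
      one_div_mul_eq_div]
  have := matVol_nonneg z
  simp only [Pi.mul_apply, siegelIntegrand]
  rw [matVol_pow, ← ENNReal.ofReal_mul (by positivity), mul_left_comm,
    inv_mul_cancel₀ (pow_ne_zero _ hz), mul_one]

end Gaussian

section Uniqueness

variable {n m : ℕ}

lemma measurable_matrix_inv : Measurable fun g : Matrix (Fin m) (Fin m) ℝ => g⁻¹ := by
  have continuous_det : Continuous fun g : Matrix (Fin m) (Fin m) ℝ => g.det := by fun_prop
  simp only [Matrix.inv_def, Ring.inverse_eq_inv']
  exact continuous_det.measurable.inv.smul continuous_id.matrix_adjugate.measurable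

lemma measurable_congr_uncurry : Measurable
    fun p : Matrix (Fin m) (Fin m) ℝ × Matrix (Fin m) (Fin m) ℝ => p.2 * p.1 * p.2ᵀ :=
  Continuous.measurable (by fun_prop)

lemma lintegral_invVolume_congr_mul {s : Matrix (Fin m) (Fin m) ℝ} (hs : s.PosDef)
    {f φ : Matrix (Fin m) (Fin m) ℝ → ENNReal} (hf : Measurable f) (hφ : Measurable φ)
    (hclass : ∀ g, φ (g * gᵀ) = φ (gᵀ * g)) :
    ∫⁻ g, f (g * s * gᵀ) * φ (gᵀ * g) ∂(invVolume m m) =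
      ∫⁻ g, f (g * gᵀ) * φ (g * s⁻¹ * gᵀ) ∂(invVolume m m) := by
  have hmeas : Measurable fun g : Matrix (Fin m) (Fin m) ℝ => f (g * gᵀ) * φ (g * s⁻¹ * gᵀ) :=
    (hf.comp (Continuous.measurable (by fun_prop))).mul
      (hφ.comp (Continuous.measurable (by fun_prop)))
  rw [← lintegral_invVolume_mul_transpose (isUnit_det_msqrt hs) hmeas]
  refine lintegral_congr fun g => ?_
  have conj_one : g * msqrt s * (g * msqrt s)ᵀ = g * s * gᵀ := by
    rw [Matrix.transpose_mul, transpose_msqrt, Matrix.mul_assoc, ← Matrix.mul_assoc (msqrt s),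
      msqrt_mul_self hs.posSemidef, Matrix.mul_assoc]
  have msqrt_mul_inv_mul : msqrt s * s⁻¹ * msqrt s = 1 := by
    nth_rw 2 [← msqrt_mul_self hs.posSemidef]
    rw [Matrix.mul_inv_rev, Matrix.mul_nonsing_inv_cancel_left _ _ (isUnit_det_msqrt hs),
      Matrix.nonsing_inv_mul _ (isUnit_det_msqrt hs)]
  have conj_inv : g * msqrt s * s⁻¹ * (g * msqrt s)ᵀ = g * gᵀ := by
    calc g * msqrt s * s⁻¹ * (g * msqrt s)ᵀ = g * (msqrt s * s⁻¹ * msqrt s) * gᵀ := by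
          simp only [Matrix.transpose_mul, transpose_msqrt, Matrix.mul_assoc]
      _ = g * gᵀ := by rw [msqrt_mul_inv_mul, Matrix.mul_one]
  rw [transpose_msqrt, conj_one, conj_inv, hclass]

lemma IsCongrInvariant.lintegral_congr_inv {μ : Measure (Matrix (Fin m) (Fin m) ℝ)}
    (hμ : IsCongrInvariant μ) {g : Matrix (Fin m) (Fin m) ℝ} (hg : IsUnit g.det)
    {φ : Matrix (Fin m) (Fin m) ℝ → ENNReal} (hφ : Measurable φ) :
    ∫⁻ s, φ (g * s⁻¹ * gᵀ) ∂μ = ∫⁻ s, φ s⁻¹ ∂μ := by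
  have hg' : IsUnit (g⁻¹)ᵀ.det := by
    rw [Matrix.det_transpose]
    exact Matrix.isUnit_nonsing_inv_det g hg
  refine Eq.trans (lintegral_congr fun s => ?_)
    (hμ.lintegral_comp hg' (hφ.comp measurable_matrix_inv))
  simp only [Matrix.mul_inv_rev, Matrix.transpose_transpose,
    ← Matrix.transpose_nonsing_inv, Matrix.nonsing_inv_nonsing_inv g hg, Matrix.mul_assoc]

/-- Weil's argument: integrate `f (g s gᵀ) φ (gᵀ g)` over `(g, s)` in both orders. -/
lemma IsCongrInvariant.lintegral_mul_lintegral {μ : Measure (Matrix (Fin m) (Fin m) ℝ)}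
    [SFinite μ] (hμ : IsCongrInvariant μ) (hpos : ∀ᵐ s ∂μ, s.PosDef) (hm : m ≠ 0)
    {f φ : Matrix (Fin m) (Fin m) ℝ → ENNReal} (hf : Measurable f) (hφ : Measurable φ)
    (hclass : ∀ g, φ (g * gᵀ) = φ (gᵀ * g)) :
    (∫⁻ s, f s ∂μ) * ∫⁻ s, φ s ∂(gramMeasure m m) =
      (∫⁻ s, φ s⁻¹ ∂μ) * ∫⁻ g, f (g * gᵀ) ∂(invVolume m m) := by
  have ae_isUnit : ∀ᵐ g ∂(invVolume m m), IsUnit g.det :=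
    (ae_invVolume_posDef hm).mono fun _ => isUnit_det_of_gram_posDef
  have hφ_gram : Measurable fun g : Matrix (Fin m) (Fin m) ℝ => φ (gᵀ * g) :=
    hφ.comp measurable_gram
  have hfφ : Measurable fun p : Matrix (Fin m) (Fin m) ℝ × Matrix (Fin m) (Fin m) ℝ =>
      f (p.2 * p.1 * p.2ᵀ) * φ (p.2ᵀ * p.2) :=
    (hf.comp measurable_congr_uncurry).mul (hφ_gram.comp measurable_snd)
  have hf' : Measurable fun g : Matrix (Fin m) (Fin m) ℝ => f (g * gᵀ) :=
    hf.comp (Continuous.measurable (by fun_prop))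
  have hf_congr (g : Matrix (Fin m) (Fin m) ℝ) : Measurable fun s => f (g * s * gᵀ) :=
    hf.comp (measurable_congr g)
  have hφ_inv (g : Matrix (Fin m) (Fin m) ℝ) : Measurable fun s => φ (g * s⁻¹ * gᵀ) :=
    (hφ.comp (measurable_congr g)).comp measurable_matrix_inv
  have hinv : Measurable fun p : Matrix (Fin m) (Fin m) ℝ × Matrix (Fin m) (Fin m) ℝ =>
      (p.1⁻¹, p.2) := (measurable_matrix_inv.comp measurable_fst).prodMk measurable_snd
  have hφ_conj_inv := (hφ.comp measurable_congr_uncurry).comp hinv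
  have hfφ' : Measurable fun p : Matrix (Fin m) (Fin m) ℝ × Matrix (Fin m) (Fin m) ℝ =>
      f (p.2 * p.2ᵀ) * φ (p.2 * p.1⁻¹ * p.2ᵀ) :=
    (hf'.comp measurable_snd).mul hφ_conj_inv
  calc (∫⁻ s, f s ∂μ) * ∫⁻ s, φ s ∂(gramMeasure m m)
      = ∫⁻ g, ∫⁻ s, f (g * s * gᵀ) * φ (gᵀ * g) ∂μ ∂(invVolume m m) := by
        rw [gramMeasure, lintegral_map hφ measurable_gram, ← lintegral_const_mul _ hφ_gram]
        refine lintegral_congr_ae (ae_isUnit.mono fun g hg => ?_)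
        dsimp only
        rw [lintegral_mul_const _ (hf_congr g), hμ.lintegral_comp hg hf]
    _ = ∫⁻ s, ∫⁻ g, f (g * s * gᵀ) * φ (gᵀ * g) ∂(invVolume m m) ∂μ :=
        (lintegral_lintegral_swap
          (f := fun s g => f (g * s * gᵀ) * φ (gᵀ * g)) hfφ.aemeasurable).symm
    _ = ∫⁻ s, ∫⁻ g, f (g * gᵀ) * φ (g * s⁻¹ * gᵀ) ∂(invVolume m m) ∂μ :=
        lintegral_congr_ae (hpos.mono fun s hs => lintegral_invVolume_congr_mul hs hf hφ hclass)
    _ = ∫⁻ g, ∫⁻ s, f (g * gᵀ) * φ (g * s⁻¹ * gᵀ) ∂μ ∂(invVolume m m) :=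
        lintegral_lintegral_swap
          (f := fun s g => f (g * gᵀ) * φ (g * s⁻¹ * gᵀ)) hfφ'.aemeasurable
    _ = (∫⁻ s, φ s⁻¹ ∂μ) * ∫⁻ g, f (g * gᵀ) ∂(invVolume m m) := by
        rw [← lintegral_const_mul _ hf']
        refine lintegral_congr_ae (ae_isUnit.mono fun g hg => ?_)
        dsimp only
        rw [lintegral_const_mul _ (hφ_inv g), hμ.lintegral_congr_inv hg hφ, mul_comm]

lemma IsCongrInvariant.exists_eq_smul {μ : Measure (Matrix (Fin m) (Fin m) ℝ)} [SFinite μ]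
    (hμ : IsCongrInvariant μ) (hpos : ∀ᵐ s ∂μ, s.PosDef) (hm : m ≠ 0) :
    ∃ c : ENNReal, μ = c • (invVolume m m).map fun g => g * gᵀ := by
  set φ : Matrix (Fin m) (Fin m) ℝ → ENNReal := fun s =>
    ENNReal.ofReal (siegelIntegrand ((m : ℝ) / 2) s)
  set G := ∫⁻ s, φ s ∂(gramMeasure m m)
  have G_eq : G = ENNReal.ofReal (Real.pi ^ ((m : ℝ) * m / 2)) :=
    lintegral_gramMeasure_siegelIntegrand le_rfl
  have G_ne_zero : G ≠ 0 := by
    rw [G_eq, ne_eq, ENNReal.ofReal_eq_zero, not_le]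
    positivity
  have G_ne_top : G ≠ ⊤ := G_eq ▸ ENNReal.ofReal_ne_top
  refine ⟨(∫⁻ s, φ s⁻¹ ∂μ) / G, Measure.ext_of_lintegral _ fun f hf => ?_⟩
  rw [lintegral_smul_measure, smul_eq_mul, lintegral_map hf (Continuous.measurable (by fun_prop)),
    ← ENNReal.mul_left_inj G_ne_zero G_ne_top,
    hμ.lintegral_mul_lintegral hpos hm hf (measurable_siegelIntegrand _).ennreal_ofReal
      fun g => by rw [siegelIntegrand_mul_transpose],
    mul_right_comm, ENNReal.div_mul_cancel G_ne_zero G_ne_top]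

lemma dStar_coneInterval_ne_zero {a b s : Matrix (Fin m) (Fin m) ℝ} (hs : s.PosDef)
    (h : s ∈ coneInterval a b) : dStar m (coneInterval a b) ≠ 0 := by
  have hac : (lebSym m).restrict (cone m) ≪ dStar m :=
    withDensity_absolutelyContinuous' (measurable_det_rpow _).aemeasurable <|
      (ae_restrict_cone_posDef _).mono fun r hr =>
        (ENNReal.ofReal_pos.2 (Real.rpow_pos_of_pos hr.det_pos _)).ne'
  have symOfUpper_s := symOfUpper_upperOfSym hs.isHermitian
  have hcont := continuous_symOfUpper.continuousAt (x := upperOfSym s)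
  intro h0
  have null := hac h0
  rw [Measure.restrict_apply (measurableSet_coneInterval a b), lebSym,
    Measure.map_apply continuous_symOfUpper.measurable
      ((measurableSet_coneInterval a b).inter measurableSet_cone)] at null
  refine (Measure.measure_pos_of_mem_nhds volume (x := upperOfSym s) ?_).ne' null
  exact (eventually_mem_coneInterval hcont isHermitian_symOfUpper (symOfUpper_s.symm ▸ h)).and
    (eventually_posDef hcont (.of_forall isHermitian_symOfUpper) (symOfUpper_s.symm ▸ hs))

lemma exists_gramMeasure_eq_smul_dStar (hm : m ≠ 0) (hmn : m ≤ n) :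
    ∃ κ : ENNReal, κ ≠ 0 ∧ κ ≠ ⊤ ∧ gramMeasure n m = κ • dStar m := by
  have hn : n ≠ 0 := by omega
  obtain ⟨c, hc⟩ := isCongrInvariant_gramMeasure.exists_eq_smul
    (ae_gramMeasure_posDef (n := n) (m := m) hn) hm
  obtain ⟨d, hd⟩ := isCongrInvariant_dStar.exists_eq_smul (ae_dStar_posDef (m := m)) hm
  set H := (invVolume m m).map fun g => g * gᵀ
  have c_mul : c * ∫⁻ s, ENNReal.ofReal (siegelIntegrand ((n : ℝ) / 2) s) ∂H =
      ENNReal.ofReal (Real.pi ^ ((n : ℝ) * m / 2)) := by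
    rw [← smul_eq_mul, ← lintegral_smul_measure, ← hc, lintegral_gramMeasure_siegelIntegrand hmn]
  have c_mul_ne_zero : ENNReal.ofReal (Real.pi ^ ((n : ℝ) * m / 2)) ≠ 0 := by
    rw [ne_eq, ENNReal.ofReal_eq_zero, not_le]
    positivity
  rw [← c_mul] at c_mul_ne_zero
  have c_ne_top : c ≠ ⊤ := fun h => by
    rw [h, ENNReal.top_mul (right_ne_zero_of_mul c_mul_ne_zero)] at c_mul
    exact ENNReal.ofReal_ne_top c_mul.symm
  set I := coneInterval ((1 / 2 : ℝ) • (1 : Matrix (Fin m) (Fin m) ℝ)) ((2 : ℝ) • 1)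
  have one_mem : 1 ∈ I := by
    constructor
    · rw [show (1 - (1 / 2 : ℝ) • 1 : Matrix (Fin m) (Fin m) ℝ) = (1 / 2 : ℝ) • 1 by module]
      exact Matrix.PosDef.one.smul one_half_pos
    · rw [show ((2 : ℝ) • 1 - 1 : Matrix (Fin m) (Fin m) ℝ) = 1 by module]
      exact Matrix.PosDef.one
  have d_mul : d * H I = dStar m I := by rw [hd, Measure.smul_apply, smul_eq_mul]
  have d_mul_ne_zero : d * H I ≠ 0 :=
    d_mul ▸ dStar_coneInterval_ne_zero Matrix.PosDef.one one_mem
  have d_ne_top : d ≠ ⊤ := fun h => by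
    rw [h, ENNReal.top_mul (right_ne_zero_of_mul d_mul_ne_zero)] at d_mul
    exact (dStar_coneInterval_lt_top (Matrix.PosDef.one.smul one_half_pos)).ne d_mul.symm
  have d_ne_zero := left_ne_zero_of_mul d_mul_ne_zero
  refine ⟨c / d, ENNReal.div_ne_zero.2 ⟨left_ne_zero_of_mul c_mul_ne_zero, d_ne_top⟩,
    ENNReal.div_ne_top c_ne_top d_ne_zero, ?_⟩
  rw [hd, smul_smul, ENNReal.div_mul_cancel d_ne_zero d_ne_top, hc]

theorem gramMeasure_eq_smul_dStar (hm : m ≠ 0) (hmn : m ≤ n) :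
    0 < stiefelMass n m / 2 ^ m ∧
      gramMeasure n m = ENNReal.ofReal (stiefelMass n m / 2 ^ m) • dStar m := by
  obtain ⟨κ, κ_ne_zero, κ_ne_top, hκ⟩ := exists_gramMeasure_eq_smul_dStar hm hmn
  have pi_pow_pos : 0 < Real.pi ^ ((n : ℝ) * m / 2) := by positivity
  have κ_mul_gamma : κ.toReal * siegelGamma m ((n : ℝ) / 2) = Real.pi ^ ((n : ℝ) * m / 2) := by
    rw [siegelGamma_eq_toReal, ← ENNReal.toReal_mul, ← smul_eq_mul κ, ← lintegral_smul_measure,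
      ← hκ, lintegral_gramMeasure_siegelIntegrand hmn, ENNReal.toReal_ofReal pi_pow_pos.le]
  have gamma_ne_zero : siegelGamma m ((n : ℝ) / 2) ≠ 0 :=
    right_ne_zero_of_mul (κ_mul_gamma.trans_ne pi_pow_pos.ne')
  have stiefelMass_div : stiefelMass n m / 2 ^ m = κ.toReal := by
    rw [stiefelMass, ← κ_mul_gamma]
    field_simp
  rw [stiefelMass_div, ENNReal.ofReal_toReal κ_ne_top]
  exact ⟨ENNReal.toReal_pos κ_ne_zero κ_ne_top, hκ⟩

end Uniqueness

/-! ### Complex measures -/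

section ComplexMeasure

variable {X : Type*} [MeasurableSpace X]

theorem variation_le_totalVariation_re_add_im (ν : ComplexMeasure X) :
    ν.variation ≤ ν.re.totalVariation + ν.im.totalVariation := by
  refine VectorMeasure.variation_le_of_forall_enorm_le fun s _ => ?_
  have hnorm : ‖ν s‖ₑ ≤ ‖ν.re s‖ₑ + ‖ν.im s‖ₑ := by
    rw [← ofReal_norm, ← ofReal_norm, ← ofReal_norm,
      ← ENNReal.ofReal_add (norm_nonneg _) (norm_nonneg _)]
    exact ENNReal.ofReal_le_ofReal (Complex.norm_le_abs_re_add_abs_im (ν s))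
  rw [Measure.add_apply]
  exact hnorm.trans <| add_le_add (SignedMeasure.enorm_le_totalVariation _ _)
    (SignedMeasure.enorm_le_totalVariation _ _)

instance isFiniteMeasure_variation (ν : ComplexMeasure X) : IsFiniteMeasure ν.variation :=
  isFiniteMeasure_of_le _ (variation_le_totalVariation_re_add_im ν)

theorem withDensityᵥ_rnDeriv_eq {ν : ComplexMeasure X} {μ : Measure X} [SigmaFinite μ]
    (h : ν ≪ᵥ μ.toENNRealVectorMeasure) : μ.withDensityᵥ (ν.rnDeriv μ) = ν := by
  have hac := (ComplexMeasure.absolutelyContinuous_ennreal_iff ν _).1 h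
  have hre := SignedMeasure.withDensityᵥ_rnDeriv_eq _ _ hac.1
  have him := SignedMeasure.withDensityᵥ_rnDeriv_eq _ _ hac.2
  have hint := ComplexMeasure.integrable_rnDeriv ν μ
  ext s hs
  rw [withDensityᵥ_apply hint hs]
  apply Complex.ext
  · rw [← RCLike.re_eq_complex_re, ← integral_re hint.integrableOn]
    refine Eq.trans ?_ (congrArg (fun τ : SignedMeasure X => τ s) hre)
    rw [withDensityᵥ_apply (SignedMeasure.integrable_rnDeriv _ _) hs]
    rfl
  · rw [← RCLike.im_eq_complex_im, ← integral_im hint.integrableOn]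
    refine Eq.trans ?_ (congrArg (fun τ : SignedMeasure X => τ s) him)
    rw [withDensityᵥ_apply (SignedMeasure.integrable_rnDeriv _ _) hs]
    rfl

/-- `k` is a phase of the complex measure `ν`, i.e. `dν = k d|ν|` is a polar decomposition
of `ν`. The modulus of `k` is required to be `1` everywhere, not only almost everywhere. -/
structure IsPhase (ν : ComplexMeasure X) (k : X → ℂ) : Prop where
  measurable : Measurable k
  norm_eq_one : ∀ x, ‖k x‖ = 1
  withDensityᵥ_eq : ν.variation.withDensityᵥ k = ν

theorem norm_ae_eq_one_of_withDensityᵥ_eq {ν : ComplexMeasure X} {h : X → ℂ}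
    (hint : Integrable h ν.variation) (hν : ν.variation.withDensityᵥ h = ν) :
    ∀ᵐ x ∂ν.variation, ‖h x‖ = 1 := by
  have henorm : (fun x => ‖h x‖ₑ) =ᵐ[ν.variation] fun _ => 1 := by
    rw [← withDensity_eq_iff_of_sigmaFinite hint.aestronglyMeasurable.enorm aemeasurable_const,
      ← Measure.variation_withDensityᵥ hint, hν]
    exact withDensity_one.symm
  filter_upwards [henorm] with x hx
  rw [← toReal_enorm, hx, ENNReal.toReal_one]

theorem exists_isPhase (ν : ComplexMeasure X) : ∃ k, IsPhase ν k := by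
  classical
  have hint := ComplexMeasure.integrable_rnDeriv ν ν.variation
  have hν : ν.variation.withDensityᵥ (ν.rnDeriv ν.variation) = ν :=
    withDensityᵥ_rnDeriv_eq (VectorMeasure.absolutelyContinuous ν)
  obtain ⟨g, hgm, hg⟩ := hint.aestronglyMeasurable
  refine ⟨fun x => if ‖g x‖ = 1 then g x else 1,
    Measurable.ite (hgm.measurable.norm (measurableSet_singleton 1)) hgm.measurable
      measurable_const, fun x => ?_, (WithDensityᵥEq.congr_ae ?_).trans hν⟩
  · split_ifs with hx
    exacts [hx, norm_one]
  · filter_upwards [norm_ae_eq_one_of_withDensityᵥ_eq hint hν, hg] with x hx hgx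
    rw [if_pos (hgx ▸ hx), hgx]

theorem continuous_integral_mul {μ : Measure X} {k : X → ℂ} (hk : Measurable k)
    (hk1 : ∀ x, ‖k x‖ ≤ 1) : Continuous fun f : X →₁[μ] ℂ => ∫ x, f x * k x ∂μ := by
  have hint : ∀ f : X →₁[μ] ℂ, Integrable (fun x => f x * k x) μ := fun f =>
    (L1.integrable_coeFn f).mul_bdd hk.aestronglyMeasurable (Eventually.of_forall hk1)
  have hL1 : ∀ f : X →₁[μ] ℂ, ∫ x, f x * k x ∂μ = ∫ x, (hint f).toL1 _ x ∂μ := fun f =>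
    integral_congr_ae (Integrable.coeFn_toL1 _).symm
  simp only [hL1]
  refine continuous_integral.comp (LipschitzWith.continuous (K := 1) fun f g => ?_)
  rw [ENNReal.coe_one, one_mul, Integrable.edist_toL1_toL1, L1.edist_def]
  refine lintegral_mono fun x => ?_
  rw [edist_eq_enorm_sub, edist_eq_enorm_sub, ← sub_mul, enorm_mul]
  exact mul_le_of_le_one_right' (by
    rw [← ofReal_norm, ENNReal.ofReal_le_one]
    exact hk1 x)

namespace IsPhase

variable {ν : ComplexMeasure X} {k : X → ℂ}

theorem integrable_mul_iff (hk : IsPhase ν k) {g : X → ℂ} :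
    Integrable (fun x => g x * k x) ν.variation ↔ Integrable g ν.variation := by
  refine ⟨fun h => ?_, fun h => h.mul_bdd hk.measurable.aestronglyMeasurable
    (Eventually.of_forall fun x => (hk.norm_eq_one x).le)⟩
  have hbdd : ∀ x, ‖k⁻¹ x‖ ≤ 1 := fun x => by
    rw [Pi.inv_apply, norm_inv, hk.norm_eq_one, inv_one]
  refine (h.mul_bdd hk.measurable.inv.aestronglyMeasurable
    (Eventually.of_forall hbdd)).congr (Eventually.of_forall fun x => ?_)
  have hx : k x ≠ 0 := norm_ne_zero_iff.1 ((hk.norm_eq_one x).trans_ne one_ne_zero)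
  exact mul_inv_cancel_right₀ hx (g x)

theorem integral_eq (hk : IsPhase ν k) (g : X → ℂ) :
    ν.integral g (ContinuousLinearMap.mul ℝ ℂ) = ∫ x, g x * k x ∂ν.variation := by
  by_cases hg : Integrable g ν.variation
  swap
  · rw [VectorMeasure.integral_undef hg, integral_undef (hk.integrable_mul_iff.not.2 hg)]
  have hkint : Integrable k ν.variation := Integrable.of_bound
    hk.measurable.aestronglyMeasurable 1 (Eventually.of_forall fun x => (hk.norm_eq_one x).le)
  refine Integrable.induction
    (fun g => ν.integral g (ContinuousLinearMap.mul ℝ ℂ) = ∫ x, g x * k x ∂ν.variation)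
    (fun c s hs _ => ?_) (fun f g _ hf hg hf' hg' => ?_) ?_ (fun f g hfg _ hf' => ?_) hg
  · have hmul : (fun x => s.indicator (fun _ => c) x * k x) = s.indicator fun x => c * k x :=
      funext fun x => (Set.indicator_mul_left s (fun _ => c) k).symm
    rw [VectorMeasure.integral_indicator_const c hs, hmul, integral_indicator hs,
      integral_const_mul, ← withDensityᵥ_apply hkint hs, hk.withDensityᵥ_eq]
    rfl
  · rw [VectorMeasure.integral_add hf hg, hf', hg',
      ← integral_add (hk.integrable_mul_iff.2 hf) (hk.integrable_mul_iff.2 hg)]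
    simp only [Pi.add_apply, add_mul]
  · exact isClosed_eq VectorMeasure.continuous_integral
      (continuous_integral_mul hk.measurable fun x => (hk.norm_eq_one x).le)
  · rw [← VectorMeasure.integral_congr_ae hfg, hf']
    exact integral_congr_ae (hfg.mono fun x hx => by dsimp only; rw [hx])

end IsPhase

end ComplexMeasure

/-! ### Averages of translates -/

section SectionIntegral

open scoped ENNReal

variable {X Ω E : Type*} [MeasurableSpace X] [MeasurableSpace Ω] [NormedAddCommGroup E]
  {μ : Measure X} {Q : Measure Ω} {p : ℝ≥0∞} {H : X × Ω → E}

theorem lintegral_eLpNorm_prodMk_rpow [SFinite Q] (hp0 : p ≠ 0) (hp : p ≠ ∞)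
    (hH : AEStronglyMeasurable H (μ.prod Q)) :
    ∫⁻ x, eLpNorm (fun ω => H (x, ω)) p Q ^ p.toReal ∂μ =
      eLpNorm H p (μ.prod Q) ^ p.toReal := by
  have hp' : p.toReal ≠ 0 := ENNReal.toReal_ne_zero.2 ⟨hp0, hp⟩
  simp only [eLpNorm_eq_lintegral_rpow_enorm_toReal hp0 hp, ← ENNReal.rpow_mul,
    one_div, inv_mul_cancel₀ hp', ENNReal.rpow_one]
  exact (lintegral_prod _ (hH.enorm.pow_const _)).symm

theorem ae_memLp_prodMk [SFinite Q] (hp0 : p ≠ 0) (hp : p ≠ ∞)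
    (hH : MemLp H p (μ.prod Q)) : ∀ᵐ x ∂μ, MemLp (fun ω => H (x, ω)) p Q := by
  have hpos : 0 < p.toReal := ENNReal.toReal_pos hp0 hp
  have hmeas : AEMeasurable (fun x => eLpNorm (fun ω => H (x, ω)) p Q ^ p.toReal) μ := by
    simp only [eLpNorm_eq_lintegral_rpow_enorm_toReal hp0 hp, ← ENNReal.rpow_mul,
      one_div, inv_mul_cancel₀ hpos.ne', ENNReal.rpow_one]
    exact (hH.aestronglyMeasurable.enorm.pow_const _).lintegral_prod_right'
  have hfin : ∫⁻ x, eLpNorm (fun ω => H (x, ω)) p Q ^ p.toReal ∂μ ≠ ∞ := by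
    rw [lintegral_eLpNorm_prodMk_rpow hp0 hp hH.aestronglyMeasurable]
    exact ENNReal.rpow_ne_top_of_nonneg hpos.le hH.eLpNorm_ne_top
  filter_upwards [hH.aestronglyMeasurable.prodMk_left, ae_lt_top' hmeas hfin] with x hx hxfin
  exact ⟨hx, (ENNReal.rpow_lt_top_iff_of_pos hpos).1 hxfin⟩

theorem memLp_integral_prodMk [NormedSpace ℝ E] [IsFiniteMeasure Q] (hp1 : 1 ≤ p)
    (hp : p ≠ ∞) (hH : MemLp H p (μ.prod Q)) : MemLp (fun x => ∫ ω, H (x, ω) ∂Q) p μ := by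
  have hp0 : p ≠ 0 := (zero_lt_one.trans_le hp1).ne'
  have hpos : 0 < p.toReal := ENNReal.toReal_pos hp0 hp
  set C : ℝ≥0∞ := Q Set.univ ^ (1 / (1 : ℝ≥0∞).toReal - 1 / p.toReal)
  have hCfin : C ≠ ∞ := by
    refine ENNReal.rpow_ne_top_of_nonneg (sub_nonneg.2 ?_) (measure_ne_top _ _)
    rw [ENNReal.toReal_one, div_one, div_le_one hpos]
    exact (ENNReal.toReal_mono hp hp1).trans_eq' ENNReal.toReal_one.symm
  have hle : ∀ᵐ x ∂μ, ‖∫ ω, H (x, ω) ∂Q‖ₑ ^ p.toReal ≤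
      eLpNorm (fun ω => H (x, ω)) p Q ^ p.toReal * C ^ p.toReal := by
    filter_upwards [hH.aestronglyMeasurable.prodMk_left] with x hx
    rw [← ENNReal.mul_rpow_of_nonneg _ _ hpos.le]
    refine ENNReal.rpow_le_rpow ((enorm_integral_le_lintegral_enorm _).trans ?_) hpos.le
    rw [← eLpNorm_one_eq_lintegral_enorm]
    exact eLpNorm_le_eLpNorm_mul_rpow_measure_univ hp1 hx
  refine ⟨hH.aestronglyMeasurable.integral_prod_right', ?_⟩
  rw [eLpNorm_lt_top_iff_lintegral_rpow_enorm_lt_top hp0 hp]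
  refine (lintegral_mono_ae hle).trans_lt ?_
  rw [lintegral_mul_const' _ _ (ENNReal.rpow_ne_top_of_nonneg hpos.le hCfin),
    lintegral_eLpNorm_prodMk_rpow hp0 hp hH.aestronglyMeasurable]
  exact ENNReal.mul_lt_top (ENNReal.rpow_lt_top_of_nonneg hpos.le hH.eLpNorm_ne_top)
    (ENNReal.rpow_lt_top_of_nonneg hpos.le hCfin)

end SectionIntegral

section TranslateAverage

open scoped ENNReal

variable {V Ω : Type*} [AddGroup V] [MeasurableSpace Ω]

/-- The average `∫ f(x - T ω) k(ω) dQ(ω)` of the translates of `f` along `T`, weighted by `k`. -/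
noncomputable def translateAverage (Q : Measure Ω) (T : Ω → V) (k : Ω → ℂ) (f : V → ℂ)
    (x : V) : ℂ :=
  ∫ ω, f (x - T ω) * k ω ∂Q

variable [MeasurableSpace V] [MeasurableAdd V] [MeasurableSub₂ V] {μ : Measure V} [SFinite μ]
  [μ.IsAddRightInvariant] {Q : Measure Ω} [IsFiniteMeasure Q] {T : Ω → V} {k : Ω → ℂ}
  {p : ℝ≥0∞} {f : V → ℂ}

theorem measurePreserving_sub_prod (hT : Measurable T) :
    MeasurePreserving (fun q : V × Ω => (q.1 - T q.2, q.2)) (μ.prod Q) (μ.prod Q) := by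
  have hskew : MeasurePreserving (fun q : Ω × V => (q.1, q.2 - T q.1)) (Q.prod μ) (Q.prod μ) :=
    (MeasurePreserving.id Q).skew_product (g := fun ω x => x - T ω)
      (measurable_snd.sub (hT.comp measurable_fst))
      (Eventually.of_forall fun ω => (measurePreserving_sub_right μ (T ω)).map_eq)
  exact (Measure.measurePreserving_swap.comp hskew).comp Measure.measurePreserving_swap

theorem memLp_translate_mul (hT : Measurable T) (hk : Measurable k) (hk1 : ∀ ω, ‖k ω‖ ≤ 1)
    (hf : MemLp f p μ) : MemLp (fun q : V × Ω => f (q.1 - T q.2) * k q.2) p (μ.prod Q) := by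
  have htranslate : MemLp (fun q : V × Ω => f (q.1 - T q.2)) p (μ.prod Q) :=
    (hf.comp_fst Q).comp_measurePreserving (measurePreserving_sub_prod hT)
  refine MemLp.of_le htranslate (htranslate.aestronglyMeasurable.mul
    (hk.comp measurable_snd).aestronglyMeasurable) (Eventually.of_forall fun q => ?_)
  rw [norm_mul]
  exact mul_le_of_le_one_right (norm_nonneg _) (hk1 _)

theorem ae_integrable_translate_mul (hT : Measurable T) (hk : Measurable k)
    (hk1 : ∀ ω, ‖k ω‖ ≤ 1) (hp1 : 1 ≤ p) (hp : p ≠ ∞) (hf : MemLp f p μ) :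
    ∀ᵐ x ∂μ, Integrable (fun ω => f (x - T ω) * k ω) Q :=
  (ae_memLp_prodMk (zero_lt_one.trans_le hp1).ne' hp
    (memLp_translate_mul hT hk hk1 hf)).mono fun _ hx => hx.integrable hp1

theorem memLp_translateAverage (hT : Measurable T) (hk : Measurable k)
    (hk1 : ∀ ω, ‖k ω‖ ≤ 1) (hp1 : 1 ≤ p) (hp : p ≠ ∞) (hf : MemLp f p μ) :
    MemLp (translateAverage Q T k f) p μ :=
  memLp_integral_prodMk hp1 hp (memLp_translate_mul hT hk hk1 hf)

end TranslateAverage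

section FourierMultiplier

open scoped FourierTransform SchwartzMap ComplexConjugate

variable {V Ω : Type*} [MeasurableSpace Ω] [NormedAddCommGroup V] [InnerProductSpace ℝ V]
  {Q : Measure Ω} {T : Ω → V} {k : Ω → ℂ}

/-- The Fourier multiplier `ξ ↦ ∫ e^{-2πi⟨T ω, ξ⟩} k(ω) dQ(ω)` of the operator
`f ↦ translateAverage Q T k f`. -/
noncomputable def averageSymbol (Q : Measure Ω) (T : Ω → V) (k : Ω → ℂ) (ξ : V) : ℂ :=
  ∫ ω, (𝐞 (-(inner ℝ (T ω) ξ)) : ℂ) * k ω ∂Q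

theorem norm_averageSymbol_le [IsFiniteMeasure Q] (hk1 : ∀ ω, ‖k ω‖ ≤ 1) (ξ : V) :
    ‖averageSymbol Q T k ξ‖ ≤ Q.real Set.univ := by
  refine (norm_integral_le_of_norm_le_const (C := 1) (Eventually.of_forall fun ω => ?_)).trans_eq
    (one_mul _)
  rw [norm_mul, Circle.norm_coe, one_mul]
  exact hk1 ω

variable [FiniteDimensional ℝ V] [MeasurableSpace V] [BorelSpace V] {f : V → ℂ}

theorem measurable_fourierChar_inner_mul (hT : Measurable T) (hk : Measurable k) :
    Measurable fun q : V × Ω => (𝐞 (-(inner ℝ (T q.2) q.1)) : ℂ) * k q.2 := by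
  have hinner : Measurable fun q : V × Ω => -(inner ℝ (T q.2) q.1 : ℝ) :=
    ((hT.comp measurable_snd).inner measurable_fst).neg
  exact ((continuous_subtype_val.comp Real.continuous_fourierChar).measurable.comp hinner).mul
    (hk.comp measurable_snd)

theorem measurable_averageSymbol [SFinite Q] (hT : Measurable T) (hk : Measurable k) :
    Measurable (averageSymbol Q T k) :=
  (measurable_fourierChar_inner_mul hT hk).stronglyMeasurable.integral_prod_right'.measurable

theorem memLp_averageSymbol_mul [IsFiniteMeasure Q] (hT : Measurable T) (hk : Measurable k)
    (hk1 : ∀ ω, ‖k ω‖ ≤ 1) {p : ENNReal} {μ : Measure V} (hf : MemLp f p μ) :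
    MemLp (fun ξ => averageSymbol Q T k ξ * f ξ) p μ := by
  refine hf.of_le_mul (c := Q.real Set.univ)
    ((measurable_averageSymbol hT hk).aestronglyMeasurable.mul hf.aestronglyMeasurable)
    (Eventually.of_forall fun ξ => ?_)
  rw [norm_mul]
  exact mul_le_mul_of_nonneg_right (norm_averageSymbol_le hk1 ξ) (norm_nonneg _)

theorem inner_toLp_schwartz (φ : 𝓢(V, ℂ)) (F : Lp ℂ 2 (volume : Measure V)) :
    inner ℂ (φ.toLp 2) F = ∫ x, F x * conj (φ x) := by
  rw [L2.inner_def]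
  refine integral_congr_ae ?_
  filter_upwards [φ.coeFn_toLp 2] with x hx
  rw [hx, RCLike.inner_apply]

theorem fourier_compSubConst_apply (φ : 𝓢(V, ℂ)) (v ξ : V) :
    𝓕 (SchwartzMap.compSubConstCLM ℂ (-v) φ) ξ = (𝐞 (inner ℝ v ξ) : ℂ) * 𝓕 φ ξ := by
  have hcomp : ⇑(SchwartzMap.compSubConstCLM ℂ (-v) φ) = φ ∘ fun x => x + v := funext fun x => by
    rw [SchwartzMap.compSubConstCLM_apply, sub_neg_eq_add, Function.comp_apply]
  rw [SchwartzMap.fourier_coe, SchwartzMap.fourier_coe, hcomp]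
  exact congrFun (VectorFourier.fourierIntegral_comp_add_right Real.fourierChar
    (volume : Measure V) (innerₗ V) φ v) ξ

theorem integral_translate_mul_conj (φ : 𝓢(V, ℂ)) (hf : MemLp f 2 volume) (v : V) :
    ∫ x, f (x - v) * conj (φ x) =
      ∫ ξ, (𝐞 (-(inner ℝ v ξ)) : ℂ) * (𝓕 (hf.toLp f) ξ * conj (𝓕 φ ξ)) := by
  have htranslate : ∫ x, f (x - v) * conj (φ x) =
      inner ℂ ((SchwartzMap.compSubConstCLM ℂ (-v) φ).toLp 2) (hf.toLp f) := by
    rw [inner_toLp_schwartz, ← integral_add_right_eq_self _ v]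
    refine integral_congr_ae ?_
    filter_upwards [hf.coeFn_toLp] with x hx
    rw [hx, SchwartzMap.compSubConstCLM_apply, sub_neg_eq_add, add_sub_cancel_right]
  rw [htranslate, ← Lp.inner_fourier_eq, SchwartzMap.toLp_fourier_eq, inner_toLp_schwartz]
  congr 1
  ext ξ
  rw [fourier_compSubConst_apply, map_mul, AddChar.map_neg_eq_inv, Circle.coe_inv_eq_conj]
  ring

theorem integral_translateAverage_mul_conj [IsFiniteMeasure Q] (φ : 𝓢(V, ℂ))
    (hf : MemLp f 2 volume) (hT : Measurable T) (hk : Measurable k) (hk1 : ∀ ω, ‖k ω‖ ≤ 1) :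
    ∫ x, translateAverage Q T k f x * conj (φ x) =
      ∫ ξ, averageSymbol Q T k ξ * 𝓕 (hf.toLp f) ξ * conj (𝓕 φ ξ) := by
  have hφ : ∀ ψ : 𝓢(V, ℂ), MemLp (fun x => conj (ψ x)) 2 (volume : Measure V) := fun ψ => by
    exact (ψ.memLp 2 volume).star
  have hint : Integrable (fun q : V × Ω => f (q.1 - T q.2) * k q.2 * conj (φ q.1))
      ((volume : Measure V).prod Q) :=
    (memLp_translate_mul hT hk hk1 hf).integrable_mul ((hφ φ).comp_fst Q)
  have hintF : Integrable (fun q : V × Ω => (𝐞 (-(inner ℝ (T q.2) q.1)) : ℂ) * k q.2 *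
      (𝓕 (hf.toLp f) q.1 * conj (𝓕 φ q.1))) ((volume : Measure V).prod Q) := by
    have hprod : Integrable (fun ξ => 𝓕 (hf.toLp f) ξ * conj (𝓕 φ ξ)) (volume : Measure V) :=
      (Lp.memLp _).integrable_mul (hφ (𝓕 φ))
    refine (hprod.comp_fst Q).bdd_mul (c := 1)
      (measurable_fourierChar_inner_mul hT hk).aestronglyMeasurable
      (Eventually.of_forall fun q => ?_)
    rw [norm_mul, Circle.norm_coe, one_mul]
    exact hk1 _
  calc ∫ x, translateAverage Q T k f x * conj (φ x)
      = ∫ x, ∫ ω, f (x - T ω) * k ω * conj (φ x) ∂Q := by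
        simp_rw [translateAverage, integral_mul_const]
    _ = ∫ ω, (∫ x, f (x - T ω) * k ω * conj (φ x)) ∂Q := integral_integral_swap hint
    _ = ∫ ω, (∫ x, f (x - T ω) * conj (φ x)) * k ω ∂Q := by
        simp_rw [mul_right_comm _ (k _), integral_mul_const]
    _ = ∫ ω, (∫ ξ, (𝐞 (-(inner ℝ (T ω) ξ)) : ℂ) * k ω *
          (𝓕 (hf.toLp f) ξ * conj (𝓕 φ ξ))) ∂Q := by
        simp_rw [integral_translate_mul_conj φ hf, mul_right_comm _ (k _), integral_mul_const]
    _ = ∫ ξ, (∫ ω, (𝐞 (-(inner ℝ (T ω) ξ)) : ℂ) * k ω *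
          (𝓕 (hf.toLp f) ξ * conj (𝓕 φ ξ)) ∂Q) := (integral_integral_swap hintF).symm
    _ = ∫ ξ, averageSymbol Q T k ξ * 𝓕 (hf.toLp f) ξ * conj (𝓕 φ ξ) := by
        simp_rw [integral_mul_const, averageSymbol, mul_assoc]

theorem fourier_translateAverage_ae_eq [IsFiniteMeasure Q] (hf : MemLp f 2 volume)
    (hT : Measurable T) (hk : Measurable k) (hk1 : ∀ ω, ‖k ω‖ ≤ 1)
    (hA : MemLp (translateAverage Q T k f) 2 volume) :
    (𝓕 (hA.toLp _) : Lp ℂ 2 (volume : Measure V)) =ᵐ[volume]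
      fun ξ => averageSymbol Q T k ξ * 𝓕 (hf.toLp f) ξ := by
  have hM : MemLp (fun ξ => averageSymbol Q T k ξ * 𝓕 (hf.toLp f) ξ) 2 volume :=
    memLp_averageSymbol_mul hT hk hk1 (Lp.memLp _)
  suffices h : 𝓕 (hA.toLp _) = hM.toLp _ by
    rw [h]
    exact hM.coeFn_toLp
  have hdense : DenseRange (SchwartzMap.toLpCLM ℂ ℂ 2 (volume : Measure V)) :=
    SchwartzMap.denseRange_toLpCLM ENNReal.ofNat_ne_top
  refine hdense.eq_of_inner_right ℂ fun ψ => ?_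
  obtain ⟨φ, rfl⟩ : ∃ φ : 𝓢(V, ℂ), 𝓕 φ = ψ := ⟨𝓕⁻ ψ, FourierTransform.fourier_fourierInv_eq ψ⟩
  have hcongr : ∀ (φ : 𝓢(V, ℂ)) {g : V → ℂ} (hg : MemLp g 2 volume),
      inner ℂ (φ.toLp 2) (hg.toLp g) = ∫ x, g x * conj (φ x) := fun φ g hg =>
    (inner_toLp_schwartz φ _).trans
      (integral_congr_ae (hg.coeFn_toLp.mono fun x hx => by dsimp only; rw [hx]))
  calc inner ℂ ((𝓕 φ : 𝓢(V, ℂ)).toLp 2 volume) (𝓕 (hA.toLp _))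
      = ∫ x, translateAverage Q T k f x * conj (φ x) := by
        rw [← SchwartzMap.toLp_fourier_eq, Lp.inner_fourier_eq, hcongr]
    _ = ∫ ξ, averageSymbol Q T k ξ * 𝓕 (hf.toLp f) ξ * conj (𝓕 φ ξ) :=
        integral_translateAverage_mul_conj φ hf hT hk hk1
    _ = inner ℂ ((𝓕 φ : 𝓢(V, ℂ)).toLp 2 volume) (hM.toLp _) := (hcongr _ hM).symm

theorem eLpNorm_translateAverage_sub [IsFiniteMeasure Q] (hf : MemLp f 2 volume)
    (hT : Measurable T) (hk : Measurable k) (hk1 : ∀ ω, ‖k ω‖ ≤ 1) (c : ℂ) :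
    eLpNorm (fun x => translateAverage Q T k f x - c * f x) 2 volume =
      eLpNorm (fun ξ => (averageSymbol Q T k ξ - c) * 𝓕 (hf.toLp f) ξ) 2 volume := by
  have hA : MemLp (translateAverage Q T k f) 2 volume :=
    memLp_translateAverage hT hk hk1 one_le_two ENNReal.ofNat_ne_top hf
  set G : Lp ℂ 2 (volume : Measure V) := hA.toLp _ - c • hf.toLp f with hG
  have hspace : (fun x => translateAverage Q T k f x - c * f x) =ᵐ[volume] G := by
    filter_upwards [Lp.coeFn_sub (hA.toLp _) (c • hf.toLp f), Lp.coeFn_smul c (hf.toLp f),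
      hA.coeFn_toLp, hf.coeFn_toLp] with x hsub hsmul hAx hfx
    rw [hsub, Pi.sub_apply, hsmul, Pi.smul_apply, hAx, hfx, smul_eq_mul]
  have hfreq : (fun ξ => (averageSymbol Q T k ξ - c) * 𝓕 (hf.toLp f) ξ) =ᵐ[volume]
      (𝓕 G : Lp ℂ 2 (volume : Measure V)) := by
    have hFG : 𝓕 G = 𝓕 (hA.toLp _) - c • 𝓕 (hf.toLp f) := by
      rw [hG, sub_eq_add_neg, ← neg_smul, FourierTransform.fourier_add,
        FourierTransform.fourier_smul, neg_smul, ← sub_eq_add_neg]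
    rw [hFG]
    filter_upwards [Lp.coeFn_sub (𝓕 (hA.toLp _)) (c • 𝓕 (hf.toLp f)),
      Lp.coeFn_smul c (𝓕 (hf.toLp f)), fourier_translateAverage_ae_eq hf hT hk hk1 hA]
      with ξ hsub hsmul hAξ
    rw [hsub, Pi.sub_apply, hsmul, Pi.smul_apply, hAξ, smul_eq_mul, sub_mul]
  rw [eLpNorm_congr_ae hspace, eLpNorm_congr_ae hfreq, ← Lp.enorm_def, ← Lp.enorm_def,
    ← ofReal_norm, ← ofReal_norm, Lp.norm_fourier_eq]

end FourierMultiplier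

/-! ### The Fourier transform as a function of `zᵀz` -/

section FourierMeasure

variable {n m : ℕ} {ν : ComplexMeasure (Matrix (Fin n) (Fin m) ℝ)}
  {k : Matrix (Fin n) (Fin m) ℝ → ℂ}

lemma IsPhase.fourierMeasure_eq (hk : IsPhase ν k) (y : Matrix (Fin n) (Fin m) ℝ) :
    fourierMeasure ν y =
      ∫ x, Complex.exp (Complex.I * ((yᵀ * x).trace : ℂ)) * k x ∂ν.variation :=
  hk.integral_eq _

lemma measurable_fourierMeasure : Measurable (fourierMeasure ν) := by
  obtain ⟨k, hk⟩ := exists_isPhase ν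
  have continuous_kernel : Continuous fun p : Matrix (Fin n) (Fin m) ℝ × Matrix (Fin n) (Fin m) ℝ =>
      Complex.exp (Complex.I * ((p.1ᵀ * p.2).trace : ℂ)) :=
    Complex.continuous_exp.comp (continuous_const.mul (Complex.continuous_ofReal.comp
      (continuous_fst.matrix_transpose.matrix_mul continuous_snd).matrix_trace))
  rw [funext hk.fourierMeasure_eq]
  exact (continuous_kernel.measurable.mul
    (hk.measurable.comp measurable_snd)).stronglyMeasurable.integral_prod_right'.measurable

/-- The function `s ↦ (ℱν)(e s^{1/2})` on the cone, where `eᵀe = 1`. It is a measurable version of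
any `u₀` with `(ℱν)(z) = u₀(zᵀz)`, whereas `u₀` itself need not be measurable. -/
noncomputable def fourierProfile (ν : ComplexMeasure (Matrix (Fin n) (Fin m) ℝ))
    (s : Matrix (Fin m) (Fin m) ℝ) : ℂ :=
  fourierMeasure ν (stdEmb n m * msqrt s)

lemma measurable_fourierProfile : Measurable (fourierProfile ν) := by
  have measurable_mul_left : Measurable fun q : Matrix (Fin m) (Fin m) ℝ => stdEmb n m * q :=
    Continuous.measurable (by fun_prop)
  exact measurable_fourierMeasure.comp (measurable_mul_left.comp measurable_msqrt)

/-- `(ℱν)(z) = u₀(zᵀz)` at all matrices `z` of full rank. -/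
def HasFourierProfile (ν : ComplexMeasure (Matrix (Fin n) (Fin m) ℝ))
    (u₀ : Matrix (Fin m) (Fin m) ℝ → ℂ) : Prop :=
  ∀ z : Matrix (Fin n) (Fin m) ℝ, z.rank = m → fourierMeasure ν z = u₀ (zᵀ * z)

namespace HasFourierProfile

variable {u₀ : Matrix (Fin m) (Fin m) ℝ → ℂ}

lemma fourierMeasure_eq (h : HasFourierProfile ν u₀) {z : Matrix (Fin n) (Fin m) ℝ}
    (hz : (zᵀ * z).PosDef) : fourierMeasure ν z = u₀ (zᵀ * z) :=
  h z (by rw [← Matrix.rank_transpose_mul_self, Matrix.rank_of_isUnit _ hz.isUnit,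
    Fintype.card_fin])

lemma fourierProfile_eq (hmn : m ≤ n) (h : HasFourierProfile ν u₀)
    {s : Matrix (Fin m) (Fin m) ℝ} (hs : s.PosDef) : fourierProfile ν s = u₀ s := by
  have gram_eq : (stdEmb n m * msqrt s)ᵀ * (stdEmb n m * msqrt s) = s := by
    rw [Matrix.transpose_mul, transpose_msqrt, Matrix.mul_assoc,
      ← Matrix.mul_assoc _ (stdEmb n m), gram_stdEmb hmn, Matrix.one_mul,
      msqrt_mul_self hs.posSemidef]
  rw [fourierProfile, h.fourierMeasure_eq (by rwa [gram_eq]), gram_eq]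

lemma fourierMeasure_eq_fourierProfile (hmn : m ≤ n) (h : HasFourierProfile ν u₀)
    {z : Matrix (Fin n) (Fin m) ℝ} (hz : (zᵀ * z).PosDef) :
    fourierMeasure ν z = fourierProfile ν (zᵀ * z) := by
  rw [h.fourierMeasure_eq hz, h.fourierProfile_eq hmn hz]

lemma setIntegral_fourierMeasure_div_matVol_pow (hmn : m ≤ n) (h : HasFourierProfile ν u₀)
    {S : Set (Matrix (Fin m) (Fin m) ℝ)} (hS : MeasurableSet S) (hScone : S ⊆ cone m) :
    ∫ z in {z : Matrix (Fin n) (Fin m) ℝ | zᵀ * z ∈ S},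
      fourierMeasure ν z / ((matVol z ^ n : ℝ) : ℂ) =
      ∫ s in S, fourierProfile ν s ∂(gramMeasure n m) := by
  have hpre : MeasurableSet ((fun z : Matrix (Fin n) (Fin m) ℝ => zᵀ * z) ⁻¹' S) :=
    measurable_gram hS
  rw [gramMeasure, setIntegral_map hS measurable_fourierProfile.aestronglyMeasurable
    measurable_gram.aemeasurable, invVolume,
    setIntegral_withDensity_eq_setIntegral_toReal_smul measurable_invVolume_density
      (Eventually.of_forall fun _ => ENNReal.ofReal_lt_top) _ hpre]
  refine setIntegral_congr_fun hpre fun z hz => ?_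
  rw [h.fourierMeasure_eq_fourierProfile hmn (hScone hz),
    ENNReal.toReal_ofReal (inv_nonneg.2 (pow_nonneg (matVol_nonneg z) n)), Complex.real_smul,
    Complex.ofReal_inv, div_eq_inv_mul]

theorem truncatedConstant_eq (hm : m ≠ 0) (hmn : m ≤ n) (h : HasFourierProfile ν u₀)
    {A : Matrix (Fin m) (Fin m) ℝ} (hA : A.PosSemidef) (B : Matrix (Fin m) (Fin m) ℝ) :
    truncatedConstant ν A B = ∫ s in coneInterval A B, fourierProfile ν s ∂(dStar m) := by
  obtain ⟨hpos, hgram⟩ := gramMeasure_eq_smul_dStar hm hmn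
  rw [truncatedConstant, h.setIntegral_fourierMeasure_div_matVol_pow hmn
      (measurableSet_coneInterval A B) (coneInterval_subset_cone hA),
    hgram, Measure.restrict_smul, integral_smul_measure, ENNReal.toReal_ofReal hpos.le,
    Complex.real_smul, ← mul_assoc, ← Complex.ofReal_mul, ← inv_div,
    inv_mul_cancel₀ hpos.ne', Complex.ofReal_one, one_mul]

lemma fourierMeasure_mul_msqrt (hmn : m ≤ n) (h : HasFourierProfile ν u₀)
    (hu₀ : IsSymmetricOnCone u₀) {z : Matrix (Fin n) (Fin m) ℝ} (hz : (zᵀ * z).PosDef)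
    {a : Matrix (Fin m) (Fin m) ℝ} (ha : a.PosDef) :
    fourierMeasure ν (z * msqrt a) =
      fourierProfile ν (msqrt (zᵀ * z) * a * (msqrt (zᵀ * z))ᵀ) := by
  have gram_eq : (z * msqrt a)ᵀ * (z * msqrt a) = msqrt a * (zᵀ * z) * msqrt a := by
    rw [Matrix.transpose_mul, transpose_msqrt]
    simp only [Matrix.mul_assoc]
  have gram_posDef : (msqrt a * (zᵀ * z) * msqrt a).PosDef := by
    have := (posDef_congr_iff (isUnit_det_msqrt ha)).2 hz
    rwa [transpose_msqrt] at this
  rw [h.fourierMeasure_eq (by rwa [gram_eq]), gram_eq,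
    h.fourierProfile_eq hmn ((posDef_congr_iff (isUnit_det_msqrt hz)).2 ha), transpose_msqrt,
    hu₀ _ a hz ha]

theorem setIntegral_fourierMeasure_mul_msqrt (hm : m ≠ 0) (hmn : m ≤ n)
    (h : HasFourierProfile ν u₀) (hu₀ : IsSymmetricOnCone u₀) {z : Matrix (Fin n) (Fin m) ℝ}
    (hz : (zᵀ * z).PosDef) {ε : ℝ} (hε : 0 < ε) (ρ : ℝ) :
    ∫ a in coneInterval (ε • (1 : Matrix (Fin m) (Fin m) ℝ)) (ρ • 1),
      fourierMeasure ν (z * msqrt a) ∂(dStar m) =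
      truncatedConstant ν (ε • (zᵀ * z)) (ρ • (zᵀ * z)) := by
  set g := msqrt (zᵀ * z) with hg
  have hgu : IsUnit g.det := isUnit_det_msqrt hz
  have congr_smul_one : ∀ t : ℝ,
      g * (t • (1 : Matrix (Fin m) (Fin m) ℝ)) * gᵀ = t • (zᵀ * z) := fun t => by
    rw [hg, transpose_msqrt, Matrix.mul_smul, Matrix.smul_mul, Matrix.mul_one,
      msqrt_mul_self hz.posSemidef]
  have preimage_coneInterval :
      (fun s => g * s * gᵀ) ⁻¹' coneInterval (ε • (zᵀ * z)) (ρ • (zᵀ * z)) =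
        coneInterval (ε • (1 : Matrix (Fin m) (Fin m) ℝ)) (ρ • 1) := by
    ext s
    rw [Set.mem_preimage, ← congr_smul_one, ← congr_smul_one, coneInterval_congr hgu]
  rw [h.truncatedConstant_eq hm hmn (hz.posSemidef.smul hε.le)]
  conv_rhs => rw [← isCongrInvariant_dStar g hgu]
  rw [setIntegral_map (measurableSet_coneInterval _ _)
    measurable_fourierProfile.aestronglyMeasurable (measurable_congr g).aemeasurable,
    preimage_coneInterval]
  exact setIntegral_congr_fun (measurableSet_coneInterval _ _) fun a ha =>
    h.fourierMeasure_mul_msqrt hmn hu₀ hz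
      (coneInterval_subset_cone (Matrix.PosSemidef.one.smul hε.le) ha)

end HasFourierProfile

end FourierMeasure

/-! ### The truncated Calderón integral -/

section Multiplier

open scoped ENNReal

variable {X ι 𝕜 : Type*} [MeasurableSpace X] [NormedField 𝕜] {μ : Measure X} {l : Filter ι}
  [l.IsCountablyGenerated] {M : ι → X → 𝕜} {F : X → 𝕜} {c : 𝕜} {C : ℝ} {p : ℝ≥0∞}

theorem tendsto_eLpNorm_sub_const_mul (hp0 : p ≠ 0) (hp : p ≠ ∞) (hF : MemLp F p μ)
    (hM : ∀ᶠ t in l, AEStronglyMeasurable (M t) μ) (hC : ∀ᶠ t in l, ∀ᵐ x ∂μ, ‖M t x‖ ≤ C)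
    (hlim : ∀ᵐ x ∂μ, Tendsto (fun t => M t x) l (𝓝 c)) :
    Tendsto (fun t => eLpNorm (fun x => (M t x - c) * F x) p μ) l (𝓝 0) := by
  have hpos : 0 < p.toReal := ENNReal.toReal_pos hp0 hp
  have hlintegral : Tendsto (fun t => ∫⁻ x, ‖(M t x - c) * F x‖ₑ ^ p.toReal ∂μ) l
      (𝓝 (∫⁻ _, 0 ∂μ)) := by
    refine tendsto_lintegral_filter_of_dominated_convergence'
      (fun x => ENNReal.ofReal (C + ‖c‖) ^ p.toReal * ‖F x‖ₑ ^ p.toReal) ?_ ?_ ?_ ?_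
    · exact hM.mono fun t ht =>
        ((ht.sub aestronglyMeasurable_const).mul hF.aestronglyMeasurable).enorm.pow_const _
    · refine hC.mono fun t ht => ht.mono fun x hx => ?_
      rw [enorm_mul, ENNReal.mul_rpow_of_nonneg _ _ hpos.le]
      gcongr
      rw [← ofReal_norm]
      exact ENNReal.ofReal_le_ofReal ((norm_sub_le _ _).trans (by gcongr))
    · have hfin : ENNReal.ofReal (C + ‖c‖) ^ p.toReal ≠ ∞ :=
        ENNReal.rpow_ne_top_of_nonneg hpos.le ENNReal.ofReal_ne_top
      rw [lintegral_const_mul' _ _ hfin]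
      exact ENNReal.mul_ne_top hfin
        ((eLpNorm_lt_top_iff_lintegral_rpow_enorm_lt_top hp0 hp).1 hF.eLpNorm_lt_top).ne
    · filter_upwards [hlim] with x hx
      have h := ((hx.sub_const c).mul_const (F x)).enorm.ennrpow_const p.toReal
      rwa [sub_self, zero_mul, enorm_zero, ENNReal.zero_rpow_of_pos hpos] at h
  have h := hlintegral.ennrpow_const (1 / p.toReal)
  rw [lintegral_zero, ENNReal.zero_rpow_of_pos (one_div_pos.2 hpos)] at h
  simpa only [eLpNorm_eq_lintegral_rpow_enorm_toReal hp0 hp] using h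

end Multiplier

section Transfer

open scoped FourierTransform

variable {n m : ℕ} {f : Matrix (Fin n) (Fin m) ℝ → ℂ}

lemma measurePreserving_matEuclid_symm : MeasurePreserving (matEuclid n m).symm :=
  (measurePreserving_matEuclid (n := n) (m := m)).symm (matEuclid n m).toMeasurableEquiv

lemma memLp_comp_matEuclid_symm (hf : MemLp f 2 volume) :
    MemLp (f ∘ (matEuclid n m).symm) 2 volume :=
  hf.comp_measurePreserving measurePreserving_matEuclid_symm

/-- The Fourier–Plancherel transform of a square integrable function of a matrix variable. -/
noncomputable def matFourier (hf : MemLp f 2 volume) :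
    Lp (α := EuclideanSpace ℝ (Fin n × Fin m)) ℂ 2 volume :=
  𝓕 ((memLp_comp_matEuclid_symm hf).toLp _)

theorem eLpNorm_translateAverage_sub_matrix {Ω : Type*} [MeasurableSpace Ω] {Q : Measure Ω}
    [IsFiniteMeasure Q] {S : Ω → Matrix (Fin n) (Fin m) ℝ} {k : Ω → ℂ} (hf : MemLp f 2 volume)
    (hS : Measurable S) (hk : Measurable k) (hk1 : ∀ ω, ‖k ω‖ ≤ 1) (c : ℂ) :
    eLpNorm (fun x => translateAverage Q S k f x - c * f x) 2 volume =
      eLpNorm (fun ξ => (averageSymbol Q (fun ω => matEuclid n m (S ω)) k ξ - c) *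
        matFourier hf ξ) 2 volume := by
  have hT : Measurable fun ω => matEuclid n m (S ω) := (matEuclid n m).measurable.comp hS
  have hf' := memLp_comp_matEuclid_symm hf
  have haverage : MemLp (translateAverage Q (fun ω => matEuclid n m (S ω)) k
      (f ∘ (matEuclid n m).symm)) 2 volume :=
    memLp_translateAverage hT hk hk1 one_le_two ENNReal.ofNat_ne_top hf'
  have symm_sub : ∀ x y : Matrix (Fin n) (Fin m) ℝ,
      (matEuclid n m).symm (matEuclid n m x - matEuclid n m y) = x - y := fun _ _ => rfl
  have h := eLpNorm_comp_measurePreserving (p := 2) (haverage.aestronglyMeasurable.sub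
    (hf'.aestronglyMeasurable.const_mul c)) (measurePreserving_matEuclid (n := n) (m := m))
  refine Eq.trans ?_ (h.trans (eLpNorm_translateAverage_sub hf' hT hk hk1 c))
  simp only [Function.comp_def, Pi.sub_apply, translateAverage, symm_sub,
    Homeomorph.symm_apply_apply]

end Transfer

section Calderon

variable {n m : ℕ} {ν : ComplexMeasure (Matrix (Fin n) (Fin m) ℝ)}
  {k : Matrix (Fin n) (Fin m) ℝ → ℂ} {f : Matrix (Fin n) (Fin m) ℝ → ℂ}
  {u₀ : Matrix (Fin m) (Fin m) ℝ → ℂ} {ε : ℝ}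

lemma measurable_mul_msqrt :
    Measurable fun q : Matrix (Fin m) (Fin m) ℝ × Matrix (Fin n) (Fin m) ℝ =>
      q.2 * msqrt q.1 := by
  have continuous_mul : Continuous fun q : Matrix (Fin m) (Fin m) ℝ × Matrix (Fin n) (Fin m) ℝ =>
      q.2 * q.1 := continuous_snd.matrix_mul continuous_fst
  exact continuous_mul.measurable.comp
    ((measurable_msqrt.comp measurable_fst).prodMk measurable_snd)

/-- The measure `1_{εI < a < ρI} d_*a × d|ν|(y)`; the truncated Calderón integral averages the
translates by `y a^{1/2}` against it. -/
noncomputable def calderonMeasure (ν : ComplexMeasure (Matrix (Fin n) (Fin m) ℝ)) (ε ρ : ℝ) :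
    Measure (Matrix (Fin m) (Fin m) ℝ × Matrix (Fin n) (Fin m) ℝ) :=
  ((dStar m).restrict (coneInterval (ε • 1) (ρ • 1))).prod ν.variation

lemma isFiniteMeasure_restrict_dStar (hε : 0 < ε) (ρ : ℝ) : IsFiniteMeasure
    ((dStar m).restrict (coneInterval (ε • (1 : Matrix (Fin m) (Fin m) ℝ)) (ρ • 1))) :=
  isFiniteMeasure_restrict.2 (dStar_coneInterval_lt_top (Matrix.PosDef.one.smul hε)).ne

lemma isFiniteMeasure_calderonMeasure (hε : 0 < ε) (ρ : ℝ) :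
    IsFiniteMeasure (calderonMeasure ν ε ρ) := by
  have := isFiniteMeasure_restrict_dStar (m := m) hε ρ
  unfold calderonMeasure
  infer_instance

/-- The average over `calderonMeasure ν ε ρ` that represents the truncated Calderón integral, when
`k` is a phase of `ν`. -/
noncomputable def calderonAverage (ν : ComplexMeasure (Matrix (Fin n) (Fin m) ℝ))
    (k : Matrix (Fin n) (Fin m) ℝ → ℂ) (ε ρ : ℝ) (f : Matrix (Fin n) (Fin m) ℝ → ℂ) :
    Matrix (Fin n) (Fin m) ℝ → ℂ :=
  translateAverage (calderonMeasure ν ε ρ) (fun q => q.2 * msqrt q.1) (fun q => k q.2) f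

/-- The Fourier multiplier of `calderonAverage ν k ε ρ`. -/
noncomputable def calderonSymbol (ν : ComplexMeasure (Matrix (Fin n) (Fin m) ℝ))
    (k : Matrix (Fin n) (Fin m) ℝ → ℂ) (ε ρ : ℝ) : EuclideanSpace ℝ (Fin n × Fin m) → ℂ :=
  averageSymbol (calderonMeasure ν ε ρ) (fun q => matEuclid n m (q.2 * msqrt q.1)) fun q => k q.2

namespace IsPhase

lemma waveletTransform_eq (hk : IsPhase ν k) (a : Matrix (Fin m) (Fin m) ℝ)
    (x : Matrix (Fin n) (Fin m) ℝ) :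
    waveletTransform ν a f x = ∫ y, f (x - y * msqrt a) * k y ∂ν.variation :=
  hk.integral_eq _

lemma ae_integrable_calderonMeasure (hk : IsPhase ν k) (hf : MemLp f 2 volume) (hε : 0 < ε)
    (ρ : ℝ) : ∀ᵐ x, Integrable (fun q : Matrix (Fin m) (Fin m) ℝ × Matrix (Fin n) (Fin m) ℝ =>
      f (x - q.2 * msqrt q.1) * k q.2) (calderonMeasure ν ε ρ) := by
  have := isFiniteMeasure_calderonMeasure (ν := ν) hε ρ
  exact ae_integrable_translate_mul measurable_mul_msqrt (hk.measurable.comp measurable_snd)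
    (fun q => (hk.norm_eq_one q.2).le) one_le_two ENNReal.ofNat_ne_top hf

theorem ae_integrableOn_waveletTransform (hk : IsPhase ν k) (hf : MemLp f 2 volume)
    (hε : 0 < ε) (ρ : ℝ) : ∀ᵐ x, IntegrableOn (fun a => waveletTransform ν a f x)
      (coneInterval (ε • (1 : Matrix (Fin m) (Fin m) ℝ)) (ρ • 1)) (dStar m) := by
  filter_upwards [hk.ae_integrable_calderonMeasure hf hε ρ] with x hx
  simp only [IntegrableOn, hk.waveletTransform_eq]
  exact hx.integral_prod_left

theorem truncatedCalderon_ae_eq (hk : IsPhase ν k) (hf : MemLp f 2 volume) (hε : 0 < ε)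
    (ρ : ℝ) : truncatedCalderon ν ε ρ f =ᵐ[volume] calderonAverage ν k ε ρ f := by
  filter_upwards [hk.ae_integrable_calderonMeasure hf hε ρ] with x hx
  simp only [truncatedCalderon, hk.waveletTransform_eq]
  exact (integral_prod _ hx).symm

theorem memLp_truncatedCalderon (hk : IsPhase ν k) (hf : MemLp f 2 volume) (hε : 0 < ε)
    (ρ : ℝ) : MemLp (truncatedCalderon ν ε ρ f) 2 volume := by
  have := isFiniteMeasure_calderonMeasure (ν := ν) hε ρ
  exact (memLp_congr_ae (hk.truncatedCalderon_ae_eq hf hε ρ)).2 (memLp_translateAverage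
    measurable_mul_msqrt (hk.measurable.comp measurable_snd)
    (fun q => (hk.norm_eq_one q.2).le) one_le_two ENNReal.ofNat_ne_top hf)

theorem eLpNorm_truncatedCalderon_sub (hk : IsPhase ν k) (hf : MemLp f 2 volume) (hε : 0 < ε)
    (ρ : ℝ) (c : ℂ) :
    eLpNorm (fun x => truncatedCalderon ν ε ρ f x - c * f x) 2 volume =
      eLpNorm (fun ξ => (calderonSymbol ν k ε ρ ξ - c) * matFourier hf ξ) 2 volume := by
  have := isFiniteMeasure_calderonMeasure (ν := ν) hε ρ
  exact (eLpNorm_congr_ae ((hk.truncatedCalderon_ae_eq hf hε ρ).sub EventuallyEq.rfl)).trans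
    (eLpNorm_translateAverage_sub_matrix hf measurable_mul_msqrt
      (hk.measurable.comp measurable_snd) (fun q => (hk.norm_eq_one q.2).le) c)

lemma measurable_calderonSymbol (hk : IsPhase ν k) (hε : 0 < ε) (ρ : ℝ) :
    Measurable (calderonSymbol ν k ε ρ) := by
  have := isFiniteMeasure_calderonMeasure (ν := ν) hε ρ
  exact measurable_averageSymbol ((matEuclid n m).measurable.comp measurable_mul_msqrt)
    (hk.measurable.comp measurable_snd)

end IsPhase

lemma fourierChar_inner_matEuclid_mul_msqrt (a : Matrix (Fin m) (Fin m) ℝ)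
    (y ζ : Matrix (Fin n) (Fin m) ℝ) :
    (Real.fourierChar (-(inner ℝ (matEuclid n m (y * msqrt a)) (matEuclid n m ζ))) : ℂ) =
      Complex.exp (Complex.I * (((((-(2 * Real.pi)) • ζ) * msqrt a)ᵀ * y).trace : ℂ)) := by
  have trace_eq : ((((-(2 * Real.pi)) • ζ) * msqrt a)ᵀ * y).trace =
      -(2 * Real.pi) * (ζᵀ * (y * msqrt a)).trace := by
    rw [Matrix.transpose_mul, transpose_msqrt, Matrix.mul_assoc, Matrix.trace_mul_comm,
      Matrix.transpose_smul, Matrix.smul_mul, Matrix.smul_mul, Matrix.trace_smul, smul_eq_mul,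
      Matrix.mul_assoc]
  rw [Real.fourierChar_apply, inner_matEuclid, trace_eq]
  congr 1
  push_cast
  ring

theorem IsPhase.calderonSymbol_matEuclid (hk : IsPhase ν k) (hε : 0 < ε) (ρ : ℝ)
    (ζ : Matrix (Fin n) (Fin m) ℝ) :
    calderonSymbol ν k ε ρ (matEuclid n m ζ) =
      ∫ a in coneInterval (ε • (1 : Matrix (Fin m) (Fin m) ℝ)) (ρ • 1),
        fourierMeasure ν (((-(2 * Real.pi)) • ζ) * msqrt a) ∂(dStar m) := by
  have := isFiniteMeasure_restrict_dStar (m := m) hε ρ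
  have hT : Measurable fun q : Matrix (Fin m) (Fin m) ℝ × Matrix (Fin n) (Fin m) ℝ =>
      matEuclid n m (q.2 * msqrt q.1) := (matEuclid n m).measurable.comp measurable_mul_msqrt
  have hmeas := (measurable_fourierChar_inner_mul hT (hk.measurable.comp measurable_snd)).comp
    (measurable_prodMk_left (x := matEuclid n m ζ))
  rw [calderonSymbol, averageSymbol, calderonMeasure, integral_prod]
  · simp only [hk.fourierMeasure_eq, fourierChar_inner_matEuclid_mul_msqrt]
  · refine Integrable.of_bound hmeas.aestronglyMeasurable 1 (Eventually.of_forall fun q => ?_)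
    rw [norm_mul, Circle.norm_coe, one_mul]
    exact (hk.norm_eq_one q.2).le

/-- The matrix `(2π)² ζᵀζ` of the point `ξ` of frequency space, identified with the matrix `ζ`. -/
noncomputable def frequencyGram (n m : ℕ) (ξ : EuclideanSpace ℝ (Fin n × Fin m)) :
    Matrix (Fin m) (Fin m) ℝ :=
  (2 * Real.pi) ^ 2 • (((matEuclid n m).symm ξ)ᵀ * (matEuclid n m).symm ξ)

lemma ae_frequencyGram_posDef (hmn : m ≤ n) : ∀ᵐ ξ, (frequencyGram n m ξ).PosDef := by
  filter_upwards [measurePreserving_matEuclid_symm.quasiMeasurePreserving.ae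
    (ae_matVol_ne_zero hmn)] with ξ hξ
  exact (gram_posDef_iff.2 hξ).smul (by positivity)

theorem calderonSymbol_eq_truncatedConstant (hk : IsPhase ν k) (hm : m ≠ 0) (hmn : m ≤ n)
    (hu₀ : IsSymmetricOnCone u₀) (hFν : HasFourierProfile ν u₀) (hε : 0 < ε) (ρ : ℝ)
    {ξ : EuclideanSpace ℝ (Fin n × Fin m)} (hξ : (frequencyGram n m ξ).PosDef) :
    calderonSymbol ν k ε ρ ξ =
      truncatedConstant ν (ε • frequencyGram n m ξ) (ρ • frequencyGram n m ξ) := by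
  obtain ⟨ζ, rfl⟩ := (matEuclid n m).surjective ξ
  have gram_eq : ((-(2 * Real.pi)) • ζ)ᵀ * ((-(2 * Real.pi)) • ζ) =
      frequencyGram n m (matEuclid n m ζ) := by
    rw [frequencyGram, Homeomorph.symm_apply_apply, Matrix.transpose_smul, Matrix.smul_mul,
      Matrix.mul_smul, smul_smul, neg_mul_neg, sq]
  rw [← gram_eq] at hξ
  rw [hk.calderonSymbol_matEuclid hε,
    hFν.setIntegral_fourierMeasure_mul_msqrt hm hmn hu₀ hξ hε, gram_eq]

theorem tendsto_eLpNorm_truncatedCalderon_sub (hm : m ≠ 0) (hmn : m ≤ n)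
    (hu₀ : IsSymmetricOnCone u₀) (hFν : HasFourierProfile ν u₀) {c : ℂ}
    (hc : Tendsto (fun p : Matrix (Fin m) (Fin m) ℝ × Matrix (Fin m) (Fin m) ℝ =>
      truncatedConstant ν p.1 p.2) (coneNhdsZero m ×ˢ coneAtTop m) (𝓝 c))
    {C : ℝ} (hC : ∀ A B : Matrix (Fin m) (Fin m) ℝ, A.PosDef → B.PosDef →
      ‖truncatedConstant ν A B‖ ≤ C)
    (hf : MemLp f 2 volume) :
    Tendsto (fun p : ℝ × ℝ =>
      eLpNorm (fun x => truncatedCalderon ν p.1 p.2 f x - c * f x) 2 volume)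
      (𝓝[>] 0 ×ˢ atTop) (𝓝 0) := by
  obtain ⟨k, hk⟩ := exists_isPhase ν
  have hpos : ∀ᶠ p : ℝ × ℝ in 𝓝[>] 0 ×ˢ atTop, 0 < p.1 ∧ 0 < p.2 :=
    (eventually_mem_nhdsWithin (s := Set.Ioi (0 : ℝ))).prod_mk (eventually_gt_atTop 0)
  refine (tendsto_eLpNorm_sub_const_mul (M := fun p : ℝ × ℝ => calderonSymbol ν k p.1 p.2)
    (C := C) two_ne_zero ENNReal.ofNat_ne_top (Lp.memLp (matFourier hf)) ?_ ?_ ?_).congr'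
    (hpos.mono fun p hp => (hk.eLpNorm_truncatedCalderon_sub hf hp.1 p.2 c).symm)
  · exact hpos.mono fun p hp => (hk.measurable_calderonSymbol hp.1 p.2).aestronglyMeasurable
  · filter_upwards [hpos] with p hp
    filter_upwards [ae_frequencyGram_posDef hmn] with ξ hξ
    rw [calderonSymbol_eq_truncatedConstant hk hm hmn hu₀ hFν hp.1 p.2 hξ]
    exact hC _ _ (hξ.smul hp.1) (hξ.smul hp.2)
  · filter_upwards [ae_frequencyGram_posDef hmn] with ξ hξ
    refine (hc.comp ((tendsto_smul_coneNhdsZero hξ).prodMap (tendsto_smul_coneAtTop hξ))).congr'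
      (hpos.mono fun p hp => ?_)
    exact (calderonSymbol_eq_truncatedConstant hk hm hmn hu₀ hFν hp.1 p.2 hξ).symm

end Calderon

end MatrixWavelet

theorem mainTheorem1 (n m : ℕ) (hm : 1 ≤ m) (hmn : m ≤ n)
    (ν : ComplexMeasure (Matrix (Fin n) (Fin m) ℝ)) (hν : IsRadial ν)
    (u₀ : Matrix (Fin m) (Fin m) ℝ → ℂ) (hu₀ : IsSymmetricOnCone u₀)
    (hFν : ∀ y : Matrix (Fin n) (Fin m) ℝ, y.rank = m → fourierMeasure ν y = u₀ (yᵀ * y))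
    (c : ℂ)
    (hc : Tendsto (fun p : Matrix (Fin m) (Fin m) ℝ × Matrix (Fin m) (Fin m) ℝ =>
      truncatedConstant ν p.1 p.2) (coneNhdsZero m ×ˢ coneAtTop m) (𝓝 c))
    (hbdd : ∃ C : ℝ, ∀ A B : Matrix (Fin m) (Fin m) ℝ, A.PosDef → B.PosDef →
      ‖truncatedConstant ν A B‖ ≤ C)
    (f : Matrix (Fin n) (Fin m) ℝ → ℂ) (hf : MemLp f 2 volume) :
    (∀ a : Matrix (Fin m) (Fin m) ℝ, a.PosDef →
      ∀ᵐ x : Matrix (Fin n) (Fin m) ℝ, ν.Integrable (fun y => f (x - y * msqrt a))) ∧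
    (∀ ε ρ : ℝ, 0 < ε → ε < ρ →
      (∀ᵐ x : Matrix (Fin n) (Fin m) ℝ,
        IntegrableOn (fun a => waveletTransform ν a f x)
          (coneInterval (ε • (1 : Matrix (Fin m) (Fin m) ℝ)) (ρ • 1)) (dStar m)) ∧
      MemLp (truncatedCalderon ν ε ρ f) 2 volume) ∧
    Tendsto (fun p : ℝ × ℝ =>
      eLpNorm (fun x => truncatedCalderon ν p.1 p.2 f x - c * f x) 2 volume)
      (𝓝[>] 0 ×ˢ atTop) (𝓝 0) := by
  obtain ⟨k, hk⟩ := exists_isPhase ν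
  obtain ⟨C, hC⟩ := hbdd
  refine ⟨fun a _ => ?_, fun ε ρ hε _ => ⟨hk.ae_integrableOn_waveletTransform hf hε ρ,
    hk.memLp_truncatedCalderon hf hε ρ⟩, tendsto_eLpNorm_truncatedCalderon_sub
      (Nat.one_le_iff_ne_zero.1 hm) hmn hu₀ hFν hc hC hf⟩
  have translates_integrable := ae_integrable_translate_mul (Q := ν.variation)
    (measurable_mul_right (msqrt a)) (measurable_const (a := (1 : ℂ))) (fun _ => norm_one.le)
    one_le_two ENNReal.ofNat_ne_top hf
  simpa only [mul_one] using translates_integrable
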